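/- \textbf{Theorem (Foxby Equivalence).} Let $R,S$ be associative unital rings; modules are left modules and right $R$-modules are $R^{op}$-modules. Let $d,k$ be integers with $d\ge 1$, $k\ge 0$, and let $n$ be an integer or $\infty$, with $n>d+1$. A module $U$ is \emph{finitely $n$-presented} if there is an exact sequence $F_n\to\cdots\to F_1\to F_0\to U\to 0$ with all $F_i$ finitely generated free (an infinite sequence $\cdots\to F_1\to F_0\to U\to 0$ if $n=\infty$; then $U$ is called super finitely presented). Let $K=K_{d-1}$ be a \emph{special faithfully semidualizing} $(S,R)$-bimodule with respect to an $(S,R)$-bimodule $C$ that is super finitely presented on both sides. That is: (i) $K$ is a $(d-1)$th syzygy of $C$, both as a left $S$-module and as a right $R$-module: on each side $K\cong\operatorname{Ker}(F_{d-1}\to F_{d-2})$, where $F_{-1}=C$, for some resolution $\cdots\to F_1\to F_0\to C\to 0$ by finitely generated free modules. (ii) $K$ is semidualizing: ${}_SK$ and $K_R$ have projective resolutions by finitely generated modules, the homothety maps $S\to\operatorname{Hom}_{R^{op}}(K,K)$ and $R\to\operatorname{Hom}_S(K,K)$ are bijective, and $\operatorname{Ext}^i_S(K,K)=0=\operatorname{Ext}^i_{R^{op}}(K,K)$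 for all $i\ge1$. (iii) $K$ is faithful: $\operatorname{Hom}_S(K,N)=0$ implies $N=0$ for every $S$-module $N$, and $\operatorname{Hom}_{R^{op}}(K,M)=0$ implies $M=0$ for every right $R$-module $M$. Define the following classes of modules. - $\mathcal I^{(n,d)}(S)$: the $S$-modules $M$ with $\operatorname{Ext}_S^{d+1}(U,M)=0$ for every finitely $n$-presented $S$-module $U$. $\mathcal F^{(n,d)}(R)$: the $R$-modules $N$ with $\operatorname{Tor}^R_{d+1}(U,N)=0$ for every finitely $n$-presented right $R$-module $U$. - $\mathcal I_K^{(n,d)}(R)$: the $R$-modules isomorphic to $\operatorname{Hom}_S(K,I)$ with $I\in\mathcal I^{(n,d)}(S)$. $\mathcal F_K^{(n,d)}(S)$: the $S$-modules isomorphic to $K\otimes_RF$ with $F\in\mathcal F^{(n,d)}(R)$. - For $\mathcal X=\mathcal I^{(n,d)}(S)$ or $\mathcal X=\mathcal I_K^{(n,d)}(R)$, $\mathcal X_{\le k}$ is the class of modules $M$ with an exact sequence $0\to M\to X_0\to\cdots\to X_k\to0$ with all $X_i\in\mathcal X$. For $\mathcal X=\mathcal F^{(n,d)}(R)$ or $\mathcal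 X=\mathcal F_K^{(n,d)}(S)$, $\mathcal X_{\le k}$ is the class of modules $M$ with an exact sequence $0\to X_k\to\cdots\to X_0\to M\to0$ with all $X_i\in\mathcal X$. - $\mathcal A_K(R)$ (the Auslander class): the $R$-modules $M$ such that $\operatorname{Tor}_i^R(K,M)=0=\operatorname{Ext}_S^i(K,K\otimes_RM)$ for all $i\ge1$ and the evaluation $\mu_M:M\to\operatorname{Hom}_S(K,K\otimes_RM)$ is an isomorphism. - $\mathcal B_K(S)$ (the Bass class): the $S$-modules $N$ such that $\operatorname{Ext}^i_S(K,N)=0=\operatorname{Tor}_i^R(K,\operatorname{Hom}_S(K,N))$ for all $i\ge1$ and the evaluation $\nu_N:K\otimes_R\operatorname{Hom}_S(K,N)\to N$ is an isomorphism. Then the functors $K\otimes_R-$ and $\operatorname{Hom}_S(K,-)$ restrict to mutually quasi-inverse equivalences of full subcategories $$\mathcal F^{(n,d)}(R)\simeq\mathcal F_K^{(n,d)}(S),\qquad \mathcal F^{(n,d)}(R)_{\le k}\simeq\mathcal F_K^{(n,d)}(S)_{\le k},\qquad \mathcal A_K(R)\simeq\mathcal B_K(S),$$ $$\mathcal I_K^{(n,d)}(R)_{\le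 k}\simeq\mathcal I^{(n,d)}(S)_{\le k},\qquad \mathcal I_K^{(n,d)}(R)\simeq\mathcal I^{(n,d)}(S),$$ with $\mu$ and $\nu$ isomorphisms on all these classes, and these equivalences are compatible with the inclusions of full subcategories $$\mathcal F^{(n,d)}(R)\subseteq\mathcal F^{(n,d)}(R)_{\le k}\subseteq\mathcal A_K(R)\supseteq\mathcal I_K^{(n,d)}(R)_{\le k}\supseteq\mathcal I_K^{(n,d)}(R),$$ $$\mathcal F_K^{(n,d)}(S)\subseteq\mathcal F_K^{(n,d)}(S)_{\le k}\subseteq\mathcal B_K(S)\supseteq\mathcal I^{(n,d)}(S)_{\le k}\supseteq\mathcal I^{(n,d)}(S).$$ Moreover, put $(n,d).\mathrm{id}_S(M)=\inf\{j\ge0:\operatorname{Ext}_S^{d+j+1}(U,M)=0\text{ for all finitely $n$-presented $S$-modules }U\}$ and $(n,d).\mathrm{fd}_R(N)=\inf\{j\ge0:\operatorname{Tor}^R_{d+j+1}(U,N)=0\text{ for all finitely $n$-presented right $R$-modules }U\}$. Then $(n,d).\mathrm{id}_S(M)\le k$ implies $M\in\mathcal I^{(n,d)}(S)_{\le k}$,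 and the converse holds if every finitely $n$-presented $S$-module is finitely $(n+1)$-presented. Likewise $(n,d).\mathrm{fd}_R(N)\le k$ implies $N\in\mathcal F^{(n,d)}(R)_{\le k}$, and the converse holds if every finitely $n$-presented right $R$-module is finitely $(n+1)$-presented. -/

import Mathlib

open CategoryTheory
open scoped TensorProduct

universe u

namespace Foxby

section Homothety

variable (R S : Type u) [Ring R] [Ring S] (K : Type u) [AddCommGroup K] [Module S K]
  [Module Rᵐᵒᵖ K] [SMulCommClass S Rᵐᵒᵖ K]

/-- Left multiplication `x ↦ s x` on an `(S, R)`-bimodule, as a map of right `R`-modules. -/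
def leftMul (s : S) : K →ₗ[Rᵐᵒᵖ] K where
  toFun x := s • x
  map_add' := smul_add s
  map_smul' r x := smul_comm s r x

/-- Right multiplication `x ↦ x r` on an `(S, R)`-bimodule, as a map of left `S`-modules. -/
def rightMul (r : R) : K →ₗ[S] K where
  toFun x := MulOpposite.op r • x
  map_add' := smul_add _
  map_smul' s x := (smul_comm s (MulOpposite.op r) x).symm

end Homothety

/-! ### Tensor product of a right module and a left module over a ring -/

section Tensor

/-- The subgroup of `U ⊗[ℤ] N` generated by the elements `(x r) ⊗ y - x ⊗ (r y)`.
A right `R`-module is a module over `Rᵐᵒᵖ`, so that `x r` is `MulOpposite.op r • x`. -/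
def balancedRelations (R : Type u) [Ring R] (U N : Type u) [AddCommGroup U] [Module Rᵐᵒᵖ U]
    [AddCommGroup N] [Module R N] : AddSubgroup (U ⊗[ℤ] N) :=
  AddSubgroup.closure
    {t | ∃ (x : U) (r : R) (y : N), t = (MulOpposite.op r • x) ⊗ₜ[ℤ] y - x ⊗ₜ[ℤ] (r • y)}

/-- The tensor product `U ⊗_R N` of a right `R`-module `U` and a left `R`-module `N`. -/
def BTensor (R : Type u) [Ring R] (U N : Type u) [AddCommGroup U] [Module Rᵐᵒᵖ U]
    [AddCommGroup N] [Module R N] : Type u :=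
  (U ⊗[ℤ] N) ⧸ balancedRelations R U N

variable (R : Type u) [Ring R] {U U' U'' N N' N'' : Type u}
  [AddCommGroup U] [Module Rᵐᵒᵖ U] [AddCommGroup U'] [Module Rᵐᵒᵖ U']
  [AddCommGroup U''] [Module Rᵐᵒᵖ U'']
  [AddCommGroup N] [Module R N] [AddCommGroup N'] [Module R N'] [AddCommGroup N''] [Module R N'']

instance : AddCommGroup (BTensor R U N) :=
  inferInstanceAs (AddCommGroup ((U ⊗[ℤ] N) ⧸ balancedRelations R U N))

namespace BTensor

/-- The elementary tensor `x ⊗ y`. -/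
def tmul (x : U) (y : N) : BTensor R U N :=
  QuotientAddGroup.mk' (balancedRelations R U N) (x ⊗ₜ[ℤ] y)

theorem tmul_add (x : U) (y y' : N) : tmul R x (y + y') = tmul R x y + tmul R x y' := by
  simp only [tmul, TensorProduct.tmul_add, map_add]; rfl

theorem add_tmul (x x' : U) (y : N) : tmul R (x + x') y = tmul R x y + tmul R x' y := by
  simp only [tmul, TensorProduct.add_tmul, map_add]; rfl

theorem smul_tmul (x : U) (r : R) (y : N) :
    tmul R (MulOpposite.op r • x) y = tmul R x (r • y) := by
  refine (QuotientAddGroup.eq_iff_sub_mem).2 (AddSubgroup.subset_closure ⟨x, r, y, rfl⟩)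

/-- The universal property: balanced biadditive maps factor through the tensor product. -/
def lift {A : Type*} [AddCommGroup A] (f : U →+ N →+ A)
    (hf : ∀ x (r : R) y, f (MulOpposite.op r • x) y = f x (r • y)) : BTensor R U N →+ A :=
  QuotientAddGroup.lift (balancedRelations R U N)
    (TensorProduct.liftAddHom f (fun r m n => by simp))
    (by
      rw [balancedRelations, AddSubgroup.closure_le]
      rintro t ⟨x, r, y, rfl⟩
      simp [hf])

@[simp]
theorem lift_tmul {A : Type*} [AddCommGroup A] (f : U →+ N →+ A)
    (hf : ∀ x (r : R) y, f (MulOpposite.op r • x) y = f x (r • y)) (x : U) (y : N) :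
    lift R f hf (tmul R x y) = f x y := rfl

theorem induction {p : BTensor R U N → Prop} (t : BTensor R U N)
    (zero : p 0) (tmul : ∀ x y, p (tmul R x y)) (add : ∀ a b, p a → p b → p (a + b)) : p t := by
  obtain ⟨t, rfl⟩ := QuotientAddGroup.mk'_surjective (balancedRelations R U N) t
  induction t with
  | zero => rw [map_zero]; exact zero
  | tmul x y => exact tmul x y
  | add a b ha hb => rw [map_add]; exact add _ _ ha hb

theorem addHom_ext {A : Type*} [AddCommGroup A] {f g : BTensor R U N →+ A}
    (h : ∀ x y, f (tmul R x y) = g (tmul R x y)) : f = g := by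
  ext t
  induction t using induction with
  | zero => simp
  | tmul x y => exact h x y
  | add a b ha hb => simp [ha, hb]

/-- Functoriality of the tensor product in both arguments. -/
def map (f : U →ₗ[Rᵐᵒᵖ] U') (g : N →ₗ[R] N') : BTensor R U N →+ BTensor R U' N' :=
  lift R
    (AddMonoidHom.mk' (fun x => AddMonoidHom.mk' (fun y => tmul R (f x) (g y))
      (fun y y' => by simp [tmul_add]))
      (fun x x' => by ext y; simp [add_tmul]))
    (fun x r y => by simp [smul_tmul])

@[simp]
theorem map_tmul (f : U →ₗ[Rᵐᵒᵖ] U') (g : N →ₗ[R] N') (x : U) (y : N) :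
    map R f g (tmul R x y) = tmul R (f x) (g y) := rfl

variable {S : Type u} [Ring S] [Module S U] [SMulCommClass S Rᵐᵒᵖ U]

/-- If `U` is an `(S, R)`-bimodule, then `U ⊗_R N` is a left `S`-module by
`s (x ⊗ y) = (s x) ⊗ y`. -/
instance : Module S (BTensor R U N) where
  smul s := map R (leftMul R S U s) LinearMap.id
  one_smul t := by
    change map R _ _ t = t
    induction t using induction with
    | zero => simp
    | tmul x y => simp [leftMul]
    | add a b ha hb => rw [map_add, ha, hb]
  mul_smul s s' t := by
    change map R _ _ t = map R _ _ (map R _ _ t)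
    induction t using induction with
    | zero => simp
    | tmul x y => simp [leftMul, mul_smul]
    | add a b ha hb => simp only [map_add, ha, hb]
  smul_zero s := map_zero (map R _ _)
  smul_add s := map_add (map R _ _)
  add_smul s s' t := by
    change map R _ _ t = map R _ _ t + map R _ _ t
    induction t using induction with
    | zero => simp
    | tmul x y => simp [leftMul, add_smul, add_tmul]
    | add a b ha hb => rw [map_add, map_add, map_add, ha, hb]; abel
  zero_smul t := by
    change map R _ _ t = 0
    induction t using induction with
    | zero => simp
    | tmul x y =>
      have h : tmul R ((0 : S) • x) y + tmul R ((0 : S) • x) y = tmul R ((0 : S) • x) y := by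
        rw [← add_tmul]; simp
      simpa [leftMul] using h
    | add a b ha hb => simp only [map_add, ha, hb, add_zero]

@[simp]
theorem smul_tmul' (s : S) (x : U) (y : N) : s • tmul R x y = tmul R (s • x) y := rfl

/-- Functoriality in the left module, as an `S`-linear map. -/
def lmap (S : Type u) [Ring S] (U : Type u) [AddCommGroup U] [Module S U] [Module Rᵐᵒᵖ U]
    [SMulCommClass S Rᵐᵒᵖ U] (g : N →ₗ[R] N') : BTensor R U N →ₗ[S] BTensor R U N' where
  toFun := map R LinearMap.id g
  map_add' := map_add _
  map_smul' s t := by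
    induction t using induction with
    | zero => simp
    | tmul x y => simp
    | add a b ha hb => simp only [smul_add, map_add, ha, hb]

@[simp]
theorem lmap_tmul (g : N →ₗ[R] N') (x : U) (y : N) :
    lmap R S U g (tmul R x y) = tmul R x (g y) := rfl

end BTensor

end Tensor

section Functors

variable (R S : Type u) [Ring R] [Ring S] (K : Type u) [AddCommGroup K] [Module S K]
  [Module Rᵐᵒᵖ K] [SMulCommClass S Rᵐᵒᵖ K]

/-- The functor `K ⊗_R -` from left `R`-modules to left `S`-modules. -/
def tensorFunctor : ModuleCat.{u} R ⥤ ModuleCat.{u} S where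
  obj M := ModuleCat.of S (BTensor R K M)
  map f := ModuleCat.ofHom (BTensor.lmap R S K f.hom)
  map_id M := by
    ext t
    induction t using BTensor.induction with
    | zero => simp
    | tmul x y => simp
    | add a b ha hb => rw [map_add, ha, hb, map_add]
  map_comp f g := by
    ext t
    induction t using BTensor.induction with
    | zero => simp
    | tmul x y => simp
    | add a b ha hb => rw [map_add, ha, hb, map_add]

/-- The abelian group `Hom_S(K, N)`. -/
def BHom (N : Type u) [AddCommGroup N] [Module S N] : Type u := K →ₗ[S] N

instance (N : Type u) [AddCommGroup N] [Module S N] : AddCommGroup (BHom S K N) :=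
  inferInstanceAs (AddCommGroup (K →ₗ[S] N))

instance (N : Type u) [AddCommGroup N] [Module S N] : FunLike (BHom S K N) K N :=
  inferInstanceAs (FunLike (K →ₗ[S] N) K N)

instance (N : Type u) [AddCommGroup N] [Module S N] : LinearMapClass (BHom S K N) S K N :=
  inferInstanceAs (LinearMapClass (K →ₗ[S] N) S K N)

variable {R S K} in
theorem BHom.ext {N : Type u} [AddCommGroup N] [Module S N] {f g : BHom S K N}
    (h : ∀ x, f x = g x) : f = g :=
  LinearMap.ext h

/-- `Hom_S(K, N)` is a left `R`-module by `(r f)(x) = f (x r)`. -/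
instance (N : Type u) [AddCommGroup N] [Module S N] : Module R (BHom S K N) where
  smul r f := LinearMap.comp (f : K →ₗ[S] N) (rightMul R S K r)
  one_smul f := BHom.ext fun x => congrArg f (one_smul Rᵐᵒᵖ x)
  mul_smul _ _ f := BHom.ext fun x => congrArg f (mul_smul _ _ x)
  smul_zero _ := rfl
  smul_add _ _ _ := rfl
  add_smul r r' f := BHom.ext fun x =>
    (congrArg f (add_smul (MulOpposite.op r) (MulOpposite.op r') x)).trans (map_add f _ _)
  zero_smul f := BHom.ext fun x => (congrArg f (zero_smul Rᵐᵒᵖ x)).trans (map_zero f)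

variable {R S K} in
theorem BHom.smul_apply {N : Type u} [AddCommGroup N] [Module S N] (r : R) (f : BHom S K N)
    (x : K) : (r • f) x = f (MulOpposite.op r • x) := rfl

/-- The functor `Hom_S(K, -)` from left `S`-modules to left `R`-modules. -/
def homFunctor : ModuleCat.{u} S ⥤ ModuleCat.{u} R where
  obj N := ModuleCat.of R (BHom S K N)
  map g := ModuleCat.ofHom
    { toFun := fun f => g.hom.comp (f : K →ₗ[S] _)
      map_add' := fun _ _ => LinearMap.comp_add _ _ _
      map_smul' := fun _ _ => rfl }
  map_id _ := rfl
  map_comp _ _ := rfl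

/-- The natural evaluation `μ_M : M ⟶ Hom_S(K, K ⊗_R M)`, `m ↦ (x ↦ x ⊗ m)`. -/
def unitEval : 𝟭 (ModuleCat.{u} R) ⟶ tensorFunctor R S K ⋙ homFunctor R S K where
  app M := ModuleCat.ofHom (Y := BHom S K (BTensor R K M))
    { toFun := fun m =>
        ({ toFun := fun x => BTensor.tmul R x m
           map_add' := fun x x' => BTensor.add_tmul R x x' m
           map_smul' := fun _ _ => rfl } : K →ₗ[S] BTensor R K M)
      map_add' := fun m m' => BHom.ext fun x => BTensor.tmul_add R x m m'
      map_smul' := fun r m => BHom.ext fun x => (BTensor.smul_tmul R x r m).symm }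
  naturality _ _ _ := rfl

/-- The evaluation `K ⊗_R Hom_S(K, N) → N`, `x ⊗ f ↦ f x`. -/
def evalMap (N : Type u) [AddCommGroup N] [Module S N] :
    BTensor R K (BHom S K N) →ₗ[S] N where
  toFun := BTensor.lift R
    (AddMonoidHom.mk' (fun x => AddMonoidHom.mk' (fun f : BHom S K N => f x)
      (fun _ _ => rfl))
      (fun x x' => by
        ext f
        exact map_add f x x'))
    (fun _ _ _ => rfl)
  map_add' := map_add _
  map_smul' := fun s t => by
    induction t using BTensor.induction with
    | zero => simp
    | tmul x f => exact map_smul f s x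
    | add a b ha hb => rw [smul_add, map_add, ha, hb, map_add, smul_add]

/-- The natural evaluation `ν_N : K ⊗_R Hom_S(K, N) ⟶ N`, `x ⊗ f ↦ f x`. -/
def counitEval : homFunctor R S K ⋙ tensorFunctor R S K ⟶ 𝟭 (ModuleCat.{u} S) where
  app N := ModuleCat.ofHom (evalMap R S K N)
  naturality _ _ _ := by
    refine ModuleCat.hom_ext (LinearMap.toAddMonoidHom_injective ?_)
    exact BTensor.addHom_ext R fun _ _ => rfl

/-- The functor `- ⊗_R N` from right `R`-modules to abelian groups. -/
def tensorRight (N : Type u) [AddCommGroup N] [Module R N] :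
    ModuleCat.{u} Rᵐᵒᵖ ⥤ AddCommGrpCat.{u} where
  obj U := AddCommGrpCat.of (BTensor R U N)
  map f := AddCommGrpCat.ofHom (BTensor.map R f.hom LinearMap.id)
  map_id U := by
    ext t
    induction t using BTensor.induction with
    | zero => simp
    | tmul x y => simp
    | add a b ha hb => rw [map_add, ha, hb, map_add]
  map_comp f g := by
    ext t
    induction t using BTensor.induction with
    | zero => simp
    | tmul x y => simp
    | add a b ha hb => rw [map_add, ha, hb, map_add]

instance (N : Type u) [AddCommGroup N] [Module R N] : (tensorRight R N).Additive where
  map_add {_ _ f g} := AddCommGrpCat.hom_ext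
    (BTensor.addHom_ext R fun x y => BTensor.add_tmul R (f x) (g x) y)

/-- `Tor_i^R(U, N)` for a right `R`-module `U` and a left `R`-module `N`: the `i`-th left derived
functor of `- ⊗_R N`, evaluated at `U`. -/
noncomputable def Tor (i : ℕ) (U : Type u) [AddCommGroup U] [Module Rᵐᵒᵖ U]
    (N : Type u) [AddCommGroup N] [Module R N] : AddCommGrpCat.{u} :=
  ((tensorRight R N).leftDerived i).obj (ModuleCat.of Rᵐᵒᵖ U)

end Functors

/-! ### Finiteness conditions and syzygies -/

/-- An exact sequence `F_n → ⋯ → F_1 → F_0 → U → 0` with every `F_i = R ^ (rank i)` free of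
finite rank; for `n = ⊤` it is an infinite resolution `⋯ → F_1 → F_0 → U → 0`. When `n` is
finite, the terms and maps beyond `F_n` are unconstrained and carry no information. -/
structure FreePresentation (R : Type u) [Ring R] (n : ℕ∞) (U : Type u) [AddCommGroup U]
    [Module R U] where
  rank : ℕ → ℕ
  d : ∀ i, (Fin (rank (i + 1)) → R) →ₗ[R] (Fin (rank i) → R)
  ε : (Fin (rank 0) → R) →ₗ[R] U
  surjective : Function.Surjective ε
  exact_zero : 0 < n → Function.Exact (d 0) ε
  exact_succ : ∀ i : ℕ, ((i + 1 : ℕ) : ℕ∞) < n → Function.Exact (d (i + 1)) (d i)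

/-- Finitely `n`-presented modules; for `n = ⊤` these are the super finitely presented ones. -/
def FinPresented (R : Type u) [Ring R] (n : ℕ∞) (U : Type u) [AddCommGroup U] [Module R U] :
    Prop :=
  Nonempty (FreePresentation R n U)

/-- The ring `R` is left `n`-coherent: finitely `n`-presented left modules are finitely
`(n+1)`-presented. -/
def IsNCoherent (R : Type u) [Ring R] (n : ℕ∞) : Prop :=
  ∀ U : ModuleCat.{u} R, FinPresented R n U → FinPresented R (n + 1) U

/-- `K` is a `(d-1)`-th syzygy of the super finitely presented module `C`: for some resolution
`⋯ → F_1 → F_0 → C → 0` by finitely generated free modules, `K ≅ Ker (F_{d-1} → F_{d-2})`, where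
`F_{-1} = C` (and `K ≅ C` if `d = 0`). -/
def IsSyzygy (R : Type u) [Ring R] (d : ℕ) (C K : Type u) [AddCommGroup C] [Module R C]
    [AddCommGroup K] [Module R K] : Prop :=
  ∃ P : FreePresentation R ⊤ C,
    match d with
    | 0 => Nonempty (K ≃ₗ[R] C)
    | 1 => Nonempty (K ≃ₗ[R] LinearMap.ker P.ε)
    | j + 2 => Nonempty (K ≃ₗ[R] LinearMap.ker (P.d j))

/-- `C` has a projective resolution by finitely generated modules. -/
def HasFiniteProjectiveResolution (R : Type u) [Ring R] (C : Type u) [AddCommGroup C]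
    [Module R C] : Prop :=
  ∃ P : ProjectiveResolution (ModuleCat.of R C), ∀ i, Module.Finite R (P.complex.X i)

/-! ### Semidualizing bimodules -/

section Semidualizing

variable (R S : Type u) [Ring R] [Ring S] (K : Type u) [AddCommGroup K] [Module S K]
  [Module Rᵐᵒᵖ K] [SMulCommClass S Rᵐᵒᵖ K]

/-- The `(S, R)`-bimodule `K` is semidualizing. The homothety maps are
`s ↦ (x ↦ s x)` and `r ↦ (x ↦ x r)`. -/
structure IsSemidualizing : Prop where
  a₁ : HasFiniteProjectiveResolution S K
  a₂ : HasFiniteProjectiveResolution Rᵐᵒᵖ K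
  b₁ : Function.Bijective (leftMul R S K)
  b₂ : Function.Bijective (rightMul R S K)
  c₁ : ∀ i : ℕ, 1 ≤ i → Subsingleton (Abelian.Ext (ModuleCat.of S K) (ModuleCat.of S K) i)
  c₂ : ∀ i : ℕ, 1 ≤ i →
    Subsingleton (Abelian.Ext (ModuleCat.of Rᵐᵒᵖ K) (ModuleCat.of Rᵐᵒᵖ K) i)

/-- The `(S, R)`-bimodule `K` is faithfully semidualizing. -/
structure IsFaithfullySemidualizing : Prop extends IsSemidualizing R S K where
  faithful_left : ∀ N : ModuleCat.{u} S, Subsingleton (K →ₗ[S] N) → Subsingleton N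
  faithful_right : ∀ M : ModuleCat.{u} Rᵐᵒᵖ, Subsingleton (K →ₗ[Rᵐᵒᵖ] M) → Subsingleton M

/-- The `(S, R)`-bimodule `K` is special faithfully semidualizing with respect to the
super finitely presented `(S, R)`-bimodule `C`: it is faithfully semidualizing, and it is a
`(d-1)`-th syzygy of `C`, both as left `S`-modules and as right `R`-modules. -/
structure IsSpecialFaithfullySemidualizing (d : ℕ) (C : Type u) [AddCommGroup C] [Module S C]
    [Module Rᵐᵒᵖ C] [SMulCommClass S Rᵐᵒᵖ C] : Prop
    extends IsFaithfullySemidualizing R S K where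
  syzygy_left : IsSyzygy S d C K
  syzygy_right : IsSyzygy Rᵐᵒᵖ d C K

/-- The Auslander class `A_K(R)`. -/
def auslanderClass : ObjectProperty (ModuleCat.{u} R) := fun M =>
  (∀ i : ℕ, 1 ≤ i → Subsingleton (Tor R i K M)) ∧
  (∀ i : ℕ, 1 ≤ i →
    Subsingleton (Abelian.Ext (ModuleCat.of S K) ((tensorFunctor R S K).obj M) i)) ∧
  IsIso ((unitEval R S K).app M)

/-- The Bass class `B_K(S)`. -/
def bassClass : ObjectProperty (ModuleCat.{u} S) := fun N =>
  (∀ i : ℕ, 1 ≤ i → Subsingleton (Abelian.Ext (ModuleCat.of S K) N i)) ∧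
  (∀ i : ℕ, 1 ≤ i → Subsingleton (Tor R i K ((homFunctor R S K).obj N))) ∧
  IsIso ((counitEval R S K).app N)

end Semidualizing

/-! ### `(n,d)`-injective and `(n,d)`-flat modules -/

section ND

/-- The class `I^{(n,d)}(S)` of `(n,d)`-injective left `S`-modules. -/
def ndInjective (S : Type u) [Ring S] (n : ℕ∞) (d : ℕ) : ObjectProperty (ModuleCat.{u} S) :=
  fun M => ∀ U : ModuleCat.{u} S, FinPresented S n U → Subsingleton (Abelian.Ext U M (d + 1))

/-- The class `F^{(n,d)}(R)` of `(n,d)`-flat left `R`-modules. -/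
def ndFlat (R : Type u) [Ring R] (n : ℕ∞) (d : ℕ) : ObjectProperty (ModuleCat.{u} R) :=
  fun N => ∀ U : ModuleCat.{u} Rᵐᵒᵖ, FinPresented Rᵐᵒᵖ n U → Subsingleton (Tor R (d + 1) U N)

/-- The number `inf {j | Ext_S^{d+j+1}(U, M) = 0 for every finitely n-presented U}`. -/
noncomputable def extDim (S : Type u) [Ring S] (n : ℕ∞) (d : ℕ) (M : ModuleCat.{u} S) : ℕ∞ :=
  ⨅ (j : ℕ) (_ : ∀ U : ModuleCat.{u} S, FinPresented S n U →
    Subsingleton (Abelian.Ext U M (d + j + 1))), (j : ℕ∞)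

/-- The number `inf {j | Tor^R_{d+j+1}(U, N) = 0 for every finitely n-presented right module U}`. -/
noncomputable def torDim (R : Type u) [Ring R] (n : ℕ∞) (d : ℕ) (N : ModuleCat.{u} R) : ℕ∞ :=
  ⨅ (j : ℕ) (_ : ∀ U : ModuleCat.{u} Rᵐᵒᵖ, FinPresented Rᵐᵒᵖ n U →
    Subsingleton (Tor R (d + j + 1) U N)), (j : ℕ∞)

/-- There is an exact sequence `0 → M → X_0 → X_1 → ⋯ → X_k → 0` with every `X_i` in the
class `X` (the terms after `X_k` are zero). -/
def coresolutionLE {R : Type u} [Ring R] (X : ObjectProperty (ModuleCat.{u} R)) (k : ℕ) :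
    ObjectProperty (ModuleCat.{u} R) := fun M =>
  ∃ (I : ℕ → ModuleCat.{u} R) (ε : M ⟶ I 0) (d : ∀ i, I i ⟶ I (i + 1)),
    (∀ i ≤ k, X (I i)) ∧ (∀ i, k < i → Subsingleton (I i)) ∧
    Function.Injective ε ∧ Function.Exact ε (d 0) ∧ ∀ i, Function.Exact (d i) (d (i + 1))

/-- There is an exact sequence `0 → X_k → ⋯ → X_1 → X_0 → M → 0` with every `X_i` in the
class `X` (the terms before `X_k` are zero). -/
def resolutionLE {R : Type u} [Ring R] (X : ObjectProperty (ModuleCat.{u} R)) (k : ℕ) :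
    ObjectProperty (ModuleCat.{u} R) := fun M =>
  ∃ (F : ℕ → ModuleCat.{u} R) (ε : F 0 ⟶ M) (d : ∀ i, F (i + 1) ⟶ F i),
    (∀ i ≤ k, X (F i)) ∧ (∀ i, k < i → Subsingleton (F i)) ∧
    Function.Surjective ε ∧ Function.Exact (d 0) ε ∧ ∀ i, Function.Exact (d (i + 1)) (d i)

variable (R S : Type u) [Ring R] [Ring S] (K : Type u) [AddCommGroup K] [Module S K]
  [Module Rᵐᵒᵖ K] [SMulCommClass S Rᵐᵒᵖ K]

/-- The class `I_K^{(n,d)}(R)` of the `R`-modules of the form `Hom_S(K, I)` with `I` an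
`(n,d)`-injective `S`-module. -/
def relInjective (n : ℕ∞) (d : ℕ) : ObjectProperty (ModuleCat.{u} R) := fun M =>
  ∃ I : ModuleCat.{u} S, ndInjective S n d I ∧ Nonempty (M ≅ (homFunctor R S K).obj I)

/-- The class `F_K^{(n,d)}(S)` of the `S`-modules of the form `K ⊗_R F` with `F` an
`(n,d)`-flat `R`-module. -/
def relFlat (n : ℕ∞) (d : ℕ) : ObjectProperty (ModuleCat.{u} S) := fun N =>
  ∃ F : ModuleCat.{u} R, ndFlat R n d F ∧ Nonempty (N ≅ (tensorFunctor R S K).obj F)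

/-- The functors `K ⊗_R -` and `Hom_S(K, -)` restrict to mutually quasi-inverse equivalences
between the full subcategories `P` of left `R`-modules and `Q` of left `S`-modules, the natural
evaluation maps being isomorphisms on `P` and on `Q`. -/
def IsFoxbyEquivalence (P : ObjectProperty (ModuleCat.{u} R))
    (Q : ObjectProperty (ModuleCat.{u} S)) : Prop :=
  ∃ (hT : ∀ M, P M → Q ((tensorFunctor R S K).obj M))
    (hH : ∀ N, Q N → P ((homFunctor R S K).obj N))
    (e : P.FullSubcategory ≌ Q.FullSubcategory),
    e.functor = Q.lift (P.ι ⋙ tensorFunctor R S K) (fun M => hT _ M.property) ∧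
    e.inverse = P.lift (Q.ι ⋙ homFunctor R S K) (fun N => hH _ N.property) ∧
    (∀ M, P M → IsIso ((unitEval R S K).app M)) ∧
    (∀ N, Q N → IsIso ((counitEval R S K).app N))

end ND

end Foxby

/-! The classes A_K(R) and B_K(S) correspond under K ⊗ - and Hom(K, -) almost by definition: the
triangle identities carry each class into the other. The work lies in placing the remaining classes
inside these two and in checking that the functors respect them.

Tor is eliminated throughout. With N^* = Hom_ℤ(N, ℚ/ℤ), the group Tor_i(U, N) vanishes for i ≥ 1
exactly when Ext^i(U, N^*) does (`tor_succ_iff`). So N is (n,d)-flat exactly when N^* is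
(n,d)-injective, and the long exact sequences of Ext suffice.

Let Ext^{d+1}(U, Y) = 0 for all super finitely presented U. Syzygies of such U are again super
finitely presented, so Ext(U, Y) vanishes in all degrees above d. Since d short exact sequences lead
from C down to K, Ext^i(K, Y) = 0 for i ≥ 1. Now take a resolution P → K by finitely generated free
modules on one side and apply Hom(-, K). As K is semidualizing, 0 → Hom(K, K) → Hom(P_0, K) → ... is
exact and starts with the ring of the other side; all further terms are finite powers of K. Its
cokernels are super finitely presented, and shifting d steps along the sequence kills their Ext^1
into Y. Hence Hom(-, Y) keeps the sequence exact (`hom_exact_of_coresolution`,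
`FreePresentation.hom_hom_exact`).

For Y = N^* this says that - ⊗ N keeps it exact. Since Hom(P_j, K) ⊗ N = Hom(P_j, K ⊗ N), the result
computes Ext(K, K ⊗ N) and shows that μ_N is an isomorphism (`ndFlat_le_auslanderClass`). For Y = I
and P over Rᵐᵒᵖ, the identity P_j ⊗ Hom(K, I) = Hom(Hom(P_j, K), I) gives the Bass conditions in the
same way (`ndInjective_le_bassClass`).

Finite resolutions and coresolutions are treated by induction on length, using two-out-of-three
properties of A_K(R) and B_K(S); two of the four cases need K to be faithful. The comparison with
the dimensions is dimension shifting along free covers and embeddings into injectives. Coherence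
enters in the converse, where syzygies must stay finitely n-presented. -/

namespace Foxby

/-! ### Short exact sequences and vanishing of `Ext` for unbundled modules -/

section Ext

variable {A : Type u} [Ring A]

/-- The sequence `0 → X₁ → X₂ → X₃ → 0` is exact. -/
structure IsSES {X₁ X₂ X₃ : Type*} [AddCommGroup X₁] [Module A X₁]
    [AddCommGroup X₂] [Module A X₂] [AddCommGroup X₃] [Module A X₃]
    (f : X₁ →ₗ[A] X₂) (g : X₂ →ₗ[A] X₃) : Prop where
  injective : Function.Injective f
  exact : Function.Exact f g
  surjective : Function.Surjective g

/-- The group `Ext^i_A(X, Y)` vanishes. -/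
abbrev ExtZero (A : Type u) [Ring A] (X Y : Type u) [AddCommGroup X] [Module A X]
    [AddCommGroup Y] [Module A Y] (i : ℕ) : Prop :=
  Subsingleton (Abelian.Ext (ModuleCat.of A X) (ModuleCat.of A Y) i)

variable {X X' X₁ X₂ X₃ Y Y' : Type u} [AddCommGroup X] [Module A X] [AddCommGroup X'] [Module A X']
  [AddCommGroup X₁] [Module A X₁] [AddCommGroup X₂] [Module A X₂] [AddCommGroup X₃] [Module A X₃]
  [AddCommGroup Y] [Module A Y] [AddCommGroup Y'] [Module A Y']

theorem IsSES.ker {g : X₂ →ₗ[A] X₃} (hg : Function.Surjective g) :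
    IsSES (LinearMap.ker g).subtype g :=
  ⟨Subtype.val_injective, fun x => by simp, hg⟩

theorem IsSES.range {f : X₁ →ₗ[A] X₂} (hf : Function.Injective f) :
    IsSES f (LinearMap.range f).mkQ :=
  ⟨hf, fun x => by simp, Submodule.mkQ_surjective _⟩

/-- The short complex in `ModuleCat` attached to a short exact sequence. -/
abbrev IsSES.shortComplex {f : X₁ →ₗ[A] X₂} {g : X₂ →ₗ[A] X₃} (h : IsSES f g) :
    ShortComplex (ModuleCat.{u} A) :=
  ModuleCat.shortComplexOfCompEqZero f g h.exact.linearMap_comp_eq_zero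

theorem IsSES.shortExact {f : X₁ →ₗ[A] X₂} {g : X₂ →ₗ[A] X₃} (h : IsSES f g) :
    h.shortComplex.ShortExact :=
  ModuleCat.shortComplex_shortExact _ h.exact h.injective h.surjective

theorem ExtZero.congr {i : ℕ} (e : X ≃ₗ[A] X') (e' : Y ≃ₗ[A] Y') (h : ExtZero A X Y i) :
    ExtZero A X' Y' i := by
  refine subsingleton_of_forall_eq 0 fun x => ?_
  have hx : ((Abelian.Ext.mk₀ e.toModuleIso.hom).comp x (zero_add i)).comp
      (Abelian.Ext.mk₀ e'.toModuleIso.inv) (add_zero i) = 0 := h.elim _ _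
  have := congrArg (fun z => ((Abelian.Ext.mk₀ e.toModuleIso.inv).comp z (zero_add i)).comp
      (Abelian.Ext.mk₀ e'.toModuleIso.hom) (add_zero i)) hx
  simpa only [Abelian.Ext.comp_assoc_of_third_deg_zero, Abelian.Ext.mk₀_comp_mk₀,
    Abelian.Ext.mk₀_comp_mk₀_assoc, Iso.inv_hom_id, Abelian.Ext.mk₀_id_comp,
    Abelian.Ext.comp_mk₀_id, Abelian.Ext.comp_zero, Abelian.Ext.zero_comp] using this

theorem ExtZero.of_projective [Module.Projective A X] (i : ℕ) : ExtZero A X Y (i + 1) := by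
  have : Projective (ModuleCat.of A X) := ModuleCat.projective_of_categoryTheory_projective _
  exact Abelian.Ext.subsingleton_of_projective _ _ _

/-! ### Vanishing and lifting from the long exact sequences (`ext_*` contravariant, `coext_*`
covariant) -/

namespace IsSES

variable {f : X₁ →ₗ[A] X₂} {g : X₂ →ₗ[A] X₃}

theorem ext_mid (h : IsSES f g) {i : ℕ} (h₁ : ExtZero A X₁ Y i) (h₃ : ExtZero A X₃ Y i) :
    ExtZero A X₂ Y i := by
  refine subsingleton_of_forall_eq 0 fun x => ?_
  obtain ⟨y, rfl⟩ := Abelian.Ext.contravariant_sequence_exact₂ h.shortExact _ x (h₁.elim _ _)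
  rw [h₃.elim y 0, Abelian.Ext.comp_zero]

theorem ext_right (h : IsSES f g) {i : ℕ} (h₁ : ExtZero A X₁ Y i) (h₂ : ExtZero A X₂ Y (i + 1)) :
    ExtZero A X₃ Y (i + 1) := by
  refine subsingleton_of_forall_eq 0 fun x => ?_
  obtain ⟨y, rfl⟩ := Abelian.Ext.contravariant_sequence_exact₃ h.shortExact _ x (h₂.elim _ _)
    (add_comm 1 i)
  rw [h₁.elim y 0, Abelian.Ext.comp_zero]

theorem ext_left (h : IsSES f g) {i : ℕ} (h₂ : ExtZero A X₂ Y i) (h₃ : ExtZero A X₃ Y (i + 1)) :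
    ExtZero A X₁ Y i := by
  refine subsingleton_of_forall_eq 0 fun x => ?_
  obtain ⟨y, rfl⟩ := Abelian.Ext.contravariant_sequence_exact₁ h.shortExact _ x
    (add_comm 1 i) (h₃.elim _ _)
  rw [h₂.elim y 0, Abelian.Ext.comp_zero]

theorem coext_left (h : IsSES f g) {i : ℕ} (h₂ : ExtZero A Y X₂ (i + 1)) (h₃ : ExtZero A Y X₃ i) :
    ExtZero A Y X₁ (i + 1) := by
  refine subsingleton_of_forall_eq 0 fun x => ?_
  obtain ⟨y, rfl⟩ := Abelian.Ext.covariant_sequence_exact₁ _ h.shortExact x (h₂.elim _ _) rfl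
  rw [h₃.elim y 0, Abelian.Ext.zero_comp]

theorem coext_right (h : IsSES f g) {i : ℕ} (h₁ : ExtZero A Y X₁ (i + 1)) (h₂ : ExtZero A Y X₂ i) :
    ExtZero A Y X₃ i := by
  refine subsingleton_of_forall_eq 0 fun x => ?_
  obtain ⟨y, rfl⟩ := Abelian.Ext.covariant_sequence_exact₃ _ h.shortExact x rfl (h₁.elim _ _)
  rw [h₂.elim y 0, Abelian.Ext.zero_comp]

theorem exists_extension (h : IsSES f g) (h₃ : ExtZero A X₃ Y 1) (φ : X₁ →ₗ[A] Y) :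
    ∃ ψ : X₂ →ₗ[A] Y, ψ ∘ₗ f = φ := by
  obtain ⟨y, hy⟩ := Abelian.Ext.contravariant_sequence_exact₁ h.shortExact _
    (Abelian.Ext.mk₀ (ModuleCat.ofHom φ)) (add_comm 1 0) (h₃.elim _ _)
  obtain ⟨ψ, rfl⟩ := Abelian.Ext.addEquiv₀.symm.surjective y
  refine ⟨ψ.hom, ?_⟩
  rw [Abelian.Ext.addEquiv₀_symm_apply, Abelian.Ext.mk₀_comp_mk₀] at hy
  exact congrArg ModuleCat.Hom.hom ((Abelian.Ext.mk₀_bijective _ _).1 hy)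

/-- Since Ext^1(X₂, Y) = 0, every class in Ext^1(X₃, Y) is the extension class followed by a map X₁
→ Y. A map that extends over X₂ kills the extension class. -/
theorem ext_one (h : IsSES f g) (h₂ : ExtZero A X₂ Y 1)
    (H : ∀ φ : X₁ →ₗ[A] Y, ∃ ψ : X₂ →ₗ[A] Y, ψ ∘ₗ f = φ) : ExtZero A X₃ Y 1 := by
  refine subsingleton_of_forall_eq 0 fun x => ?_
  obtain ⟨y, rfl⟩ := Abelian.Ext.contravariant_sequence_exact₃ h.shortExact _ x (h₂.elim _ _)
    (add_comm 1 0)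
  obtain ⟨φ, rfl⟩ := Abelian.Ext.addEquiv₀.symm.surjective y
  obtain ⟨ψ, hψ⟩ := H φ.hom
  have : φ = h.shortComplex.f ≫ ModuleCat.ofHom ψ := by
    ext1; exact hψ.symm
  rw [this, Abelian.Ext.addEquiv₀_symm_apply, ← Abelian.Ext.mk₀_comp_mk₀,
    h.shortExact.extClass_comp_assoc]

theorem exists_lift (h : IsSES f g) (h₁ : ExtZero A Y X₁ 1) (φ : Y →ₗ[A] X₃) :
    ∃ ψ : Y →ₗ[A] X₂, g ∘ₗ ψ = φ := by
  obtain ⟨y, hy⟩ := Abelian.Ext.covariant_sequence_exact₃ _ h.shortExact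
    (Abelian.Ext.mk₀ (ModuleCat.ofHom φ)) rfl (h₁.elim _ _)
  obtain ⟨ψ, rfl⟩ := Abelian.Ext.addEquiv₀.symm.surjective y
  refine ⟨ψ.hom, ?_⟩
  rw [Abelian.Ext.addEquiv₀_symm_apply, Abelian.Ext.mk₀_comp_mk₀] at hy
  exact congrArg ModuleCat.Hom.hom ((Abelian.Ext.mk₀_bijective _ _).1 hy)

theorem coext_one (h : IsSES f g) (h₂ : ExtZero A Y X₂ 1)
    (H : ∀ φ : Y →ₗ[A] X₃, ∃ ψ : Y →ₗ[A] X₂, g ∘ₗ ψ = φ) : ExtZero A Y X₁ 1 := by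
  refine subsingleton_of_forall_eq 0 fun x => ?_
  obtain ⟨y, rfl⟩ := Abelian.Ext.covariant_sequence_exact₁ _ h.shortExact x (h₂.elim _ _)
    (zero_add 1)
  obtain ⟨φ, rfl⟩ := Abelian.Ext.addEquiv₀.symm.surjective y
  obtain ⟨ψ, hψ⟩ := H φ.hom
  have : φ = ModuleCat.ofHom ψ ≫ h.shortComplex.g := by
    ext1; exact hψ.symm
  rw [this, Abelian.Ext.addEquiv₀_symm_apply, ← Abelian.Ext.mk₀_comp_mk₀,
    Abelian.Ext.comp_assoc_of_second_deg_zero, h.shortExact.comp_extClass, Abelian.Ext.comp_zero]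

/-- Hom into `Y` is left exact. -/
theorem exists_desc (h : IsSES f g) (φ : X₂ →ₗ[A] Y) (hφ : φ ∘ₗ f = 0) :
    ∃ ψ : X₃ →ₗ[A] Y, ψ ∘ₗ g = φ := by
  have hk : LinearMap.ker g ≤ LinearMap.ker φ := by
    intro x hx
    obtain ⟨y, rfl⟩ := (h.exact x).1 hx
    exact LinearMap.congr_fun hφ y
  refine ⟨(LinearMap.ker g).liftQ φ hk ∘ₗ (g.quotKerEquivOfSurjective h.surjective).symm, ?_⟩
  ext x
  have : (g.quotKerEquivOfSurjective h.surjective).symm (g x) = (LinearMap.ker g).mkQ x := by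
    rw [LinearEquiv.symm_apply_eq]; rfl
  simp [this]

end IsSES

/-- The sequence `0 → X → X^{m+1} → X^m → 0`. -/
theorem IsSES.fin_succ (X : Type u) [AddCommGroup X] [Module A X] (m : ℕ) :
    IsSES (LinearMap.single A (fun _ : Fin (m + 1) => X) 0)
      (LinearMap.funLeft A X (Fin.succ : Fin m → Fin (m + 1))) where
  injective := fun x y h => by simpa using congrFun h 0
  exact x := by
    constructor
    · intro h
      refine ⟨x 0, ?_⟩
      ext j
      refine Fin.cases (by simp) (fun j => ?_) j
      simpa using (congrFun h j).symm
    · rintro ⟨y, rfl⟩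
      ext j
      simp [LinearMap.funLeft]
  surjective y := ⟨Fin.cons 0 y, by ext j; simp [LinearMap.funLeft]⟩

theorem ExtZero.fin {i : ℕ} (h : ExtZero A X Y (i + 1)) (m : ℕ) :
    ExtZero A (Fin m → X) Y (i + 1) := by
  induction m with
  | zero => exact .of_projective i
  | succ m ih => exact (IsSES.fin_succ X m).ext_mid h ih

/-- `Ext` is computed by acyclic resolutions. -/
theorem ext_succ_iff {Y : Type u} [AddCommGroup Y] [Module A Y] (i : ℕ) :
    ∀ {X : Type u} [AddCommGroup X] [Module A X] (P : ℕ → Type u) [∀ j, AddCommGroup (P j)]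
    [∀ j, Module A (P j)] (ε : P 0 →ₗ[A] X) (d : ∀ j, P (j + 1) →ₗ[A] P j)
    (_ : Function.Surjective ε) (_ : Function.Exact (d 0) ε)
    (_ : ∀ j, Function.Exact (d (j + 1)) (d j))
    (_ : ∀ j l, ExtZero A (P j) Y (l + 1)),
    ExtZero A X Y (i + 1) ↔ ∀ φ : P (i + 1) →ₗ[A] Y, φ ∘ₗ d (i + 1) = 0 →
      ∃ ψ : P i →ₗ[A] Y, ψ ∘ₗ d i = φ := by
  induction i with
  | zero =>
    intro X _ _ P _ _ ε d hε h0 hd hP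
    have hs := IsSES.ker hε
    have hk : ∀ x, ε (d 0 x) = 0 := h0.apply_apply_eq_zero
    -- Thus ker ε is P 1 modulo the image of d 1, and maps out of it are the maps out of P 1 that
    -- vanish on this image.
    have h1 : IsSES (LinearMap.range (d 1)).subtype ((d 0).codRestrict (LinearMap.ker ε) hk) :=
      ⟨Subtype.val_injective, fun x => by
          rw [← Subtype.coe_inj]
          exact (hd 0 x).trans
            ⟨fun hx => ⟨⟨x, hx⟩, rfl⟩, by rintro ⟨⟨_, hx⟩, rfl⟩; exact hx⟩,
        fun ⟨x, hx⟩ => by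
          obtain ⟨y, hy⟩ := (h0 x).1 hx
          exact ⟨y, Subtype.ext hy⟩⟩
    constructor
    · intro H φ hφ
      obtain ⟨φ', h'⟩ := h1.exists_desc φ (by
        ext ⟨_, x, rfl⟩; exact LinearMap.congr_fun hφ x)
      obtain ⟨ψ, hψ⟩ := hs.exists_extension H φ'
      refine ⟨ψ, ?_⟩
      ext x
      rw [← h', ← hψ]; rfl
    · intro H
      refine hs.ext_one (hP 0 0) fun φ => ?_
      obtain ⟨ψ, hψ⟩ := H (φ ∘ₗ (d 0).codRestrict (LinearMap.ker ε) hk) (by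
        ext x
        have : (d 0).codRestrict (LinearMap.ker ε) hk (d 1 x) = 0 :=
          Subtype.ext ((hd 0).apply_apply_eq_zero x)
        simp [this])
      refine ⟨ψ, ?_⟩
      ext ⟨x, hx⟩
      obtain ⟨y, rfl⟩ := (h0 x).1 hx
      exact LinearMap.congr_fun hψ y
  | succ i ih =>
    intro X _ _ P _ _ ε d hε h0 hd hP
    have hs := IsSES.ker hε
    have hk : ∀ x, ε (d 0 x) = 0 := h0.apply_apply_eq_zero
    -- Dimension shift: the truncated complex resolves ker ε.
    rw [← ih (fun j => P (j + 1)) ((d 0).codRestrict (LinearMap.ker ε) hk) (fun j => d (j + 1))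
      (fun ⟨x, hx⟩ => by
          obtain ⟨y, hy⟩ := (h0 x).1 hx
          exact ⟨y, Subtype.ext hy⟩)
      (fun x => by rw [← Subtype.coe_inj]; exact hd 0 x) (fun j => hd (j + 1))
      (fun j => hP (j + 1))]
    exact ⟨fun H => hs.ext_left (hP 0 i) H, fun H => hs.ext_right H (hP 0 (i + 1))⟩

end Ext

/-! ### Super finitely presented modules -/

section FinPresented

variable {A : Type u} [Ring A]
variable {X X' X₁ X₂ X₃ Y : Type u} [AddCommGroup X] [Module A X] [AddCommGroup X'] [Module A X']
  [AddCommGroup X₁] [Module A X₁] [AddCommGroup X₂] [Module A X₂] [AddCommGroup X₃] [Module A X₃]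
  [AddCommGroup Y] [Module A Y]

theorem FinPresented.of_top (n : ℕ∞) (h : FinPresented A ⊤ X) : FinPresented A n X :=
  h.map fun P => { P with
    exact_zero := fun _ => P.exact_zero (by simp)
    exact_succ := fun i _ => P.exact_succ i (ENat.natCast_lt_top _) }

theorem FinPresented.congr {n : ℕ∞} (e : X ≃ₗ[A] X') (h : FinPresented A n X) :
    FinPresented A n X' :=
  h.map fun P => { P with
    ε := e.toLinearMap ∘ₗ P.ε
    surjective := e.surjective.comp P.surjective
    exact_zero := fun h0 x => by simpa using P.exact_zero h0 x }

theorem FreePresentation.ker_ε_apply_d {n : ℕ∞} (P : FreePresentation A (n + 1) X)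
    (x : Fin (P.rank 1) → A) : P.ε (P.d 0 x) = 0 :=
  (P.exact_zero (by simp)).apply_apply_eq_zero x

/-- The presentation of the kernel of `F_0 → U`. -/
def FreePresentation.ker {n : ℕ∞} (P : FreePresentation A (n + 1) X) :
    FreePresentation A n (LinearMap.ker P.ε) :=
  have hlt : ∀ i : ℕ, (i : ℕ∞) < n → ((i + 1 : ℕ) : ℕ∞) < n + 1 := fun i hi => by
    push_cast
    exact (ENat.add_lt_add_iff_right (by simp)).2 hi
  { rank := fun i => P.rank (i + 1)
    d := fun i => P.d (i + 1)
    ε := (P.d 0).codRestrict _ P.ker_ε_apply_d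
    surjective := fun ⟨x, hx⟩ => by
      obtain ⟨y, hy⟩ := (P.exact_zero (by simp) x).1 hx
      exact ⟨y, Subtype.ext hy⟩
    exact_zero := fun h0 x => by
      rw [← Subtype.coe_inj]
      exact P.exact_succ 0 (hlt 0 h0) x
    exact_succ := fun i hi => P.exact_succ (i + 1) (hlt _ hi) }

theorem FinPresented.exists_ker {n : ℕ∞} (h : FinPresented A (n + 1) X) :
    ∃ (m : ℕ) (ε : (Fin m → A) →ₗ[A] X),
      Function.Surjective ε ∧ FinPresented A n (LinearMap.ker ε) :=
  h.elim fun P => ⟨_, P.ε, P.surjective, ⟨P.ker⟩⟩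

/-- Coinduction for super finitely presented modules. -/
theorem FinPresented.coinduction (p : ModuleCat.{u} A → Prop)
    (hp : ∀ V, p V → ∃ (m : ℕ) (ε : (Fin m → A) →ₗ[A] V),
      Function.Surjective ε ∧ p (ModuleCat.of A (LinearMap.ker ε)))
    (h : p (ModuleCat.of A X)) : FinPresented A ⊤ X := by
  choose m ε hε hk using hp
  -- The iterated kernels, each kept with its proof of `p` so that the next cover can be chosen.
  let st : ℕ → {V : ModuleCat.{u} A // p V} := fun i =>
    Nat.rec ⟨_, h⟩ (fun _ V => ⟨_, hk V.1 V.2⟩) i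
  have key : ∀ i, Function.Exact ((LinearMap.ker (ε (st i).1 (st i).2)).subtype ∘ₗ
      (ε (st (i + 1)).1 (st (i + 1)).2)) (ε (st i).1 (st i).2) := fun i x =>
    ⟨fun hx => by
      obtain ⟨y, hy⟩ := hε (st (i + 1)).1 (st (i + 1)).2 ⟨x, hx⟩
      exact ⟨y, congrArg Subtype.val hy⟩, by
      rintro ⟨y, rfl⟩
      exact LinearMap.mem_ker.1 (ε (st (i + 1)).1 (st (i + 1)).2 y).2⟩
  exact ⟨{
    rank := fun i => m (st i).1 (st i).2
    d := fun i => (LinearMap.ker (ε (st i).1 (st i).2)).subtype ∘ₗ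
      (ε (st (i + 1)).1 (st (i + 1)).2)
    ε := ε (st 0).1 (st 0).2
    surjective := hε _ _
    exact_zero := fun _ => key 0
    exact_succ := fun i _ => by
      -- The inclusion of the kernel is injective, so composing with it leaves the kernel of the
      -- cover unchanged.
      refine fun x => Iff.trans ?_ (key (i + 1) x)
      exact Submodule.coe_eq_zero (p := LinearMap.ker (ε (st i).1 (st i).2)) }⟩

theorem FinPresented.of_ker {m : ℕ} {ε : (Fin m → A) →ₗ[A] X} (hε : Function.Surjective ε)
    (h : FinPresented A ⊤ (LinearMap.ker ε)) : FinPresented A ⊤ X :=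
  coinduction (fun V => ∃ (m : ℕ) (ε : (Fin m → A) →ₗ[A] V),
      Function.Surjective ε ∧ FinPresented A ⊤ (LinearMap.ker ε))
    (fun _ ⟨m, ε, hε, h⟩ => ⟨m, ε, hε, exists_ker (n := ⊤) h⟩) ⟨m, ε, hε, h⟩

theorem FinPresented.free (m : ℕ) : FinPresented A ⊤ (Fin m → A) :=
  ⟨{rank := fun i => Nat.casesOn i m (fun _ => 0)
    d := fun i => 0
    ε := LinearMap.id
    surjective := fun x => ⟨x, rfl⟩
    exact_zero := fun _ x => by
      constructor
      · intro h; exact ⟨0, h.symm⟩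
      · rintro ⟨y, rfl⟩; rfl
    exact_succ := fun i _ x => by
      have : Subsingleton (Fin 0 → A) := inferInstance
      exact ⟨fun _ => ⟨0, this.elim _ _⟩, fun _ => rfl⟩ }⟩

/-- Horseshoe lemma run as a coinduction: the invariant is being an extension of super finitely
presented modules. The kernel of the cover of V by the sum of the two free modules is again such an
extension. -/
theorem IsSES.finPresented_mid {f : X₁ →ₗ[A] X₂} {g : X₂ →ₗ[A] X₃} (h : IsSES f g)
    (h₁ : FinPresented A ⊤ X₁) (h₃ : FinPresented A ⊤ X₃) : FinPresented A ⊤ X₂ := by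
  refine FinPresented.coinduction (fun V => ∃ (X₁ X₃ : ModuleCat.{u} A) (f : X₁ →ₗ[A] V)
    (g : V →ₗ[A] X₃), IsSES f g ∧ FinPresented A ⊤ X₁ ∧ FinPresented A ⊤ X₃) ?_
    ⟨ModuleCat.of A X₁, ModuleCat.of A X₃, f, g, h, h₁, h₃⟩
  rintro V ⟨X₁, X₃, f, g, h, h₁, h₃⟩
  obtain ⟨m₁, ε₁, hε₁, h₁⟩ := FinPresented.exists_ker (n := ⊤) h₁
  obtain ⟨m₃, ε₃, hε₃, h₃⟩ := FinPresented.exists_ker (n := ⊤) h₃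
  obtain ⟨l, hl⟩ := Module.projective_lifting_property g ε₃ h.surjective
  have hl' : ∀ x, g (l x) = ε₃ x := LinearMap.congr_fun hl
  have hgf : ∀ x, g (f x) = 0 := h.exact.apply_apply_eq_zero
  let e : (Fin (m₁ + m₃) → A) ≃ₗ[A] (Fin m₁ → A) × (Fin m₃ → A) :=
    (LinearEquiv.funCongrLeft A A finSumFinEquiv).trans
      (LinearEquiv.sumArrowLequivProdArrow _ _ A A)
  let ε : (Fin (m₁ + m₃) → A) →ₗ[A] V := (LinearMap.coprod (f ∘ₗ ε₁) l) ∘ₗ e.toLinearMap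
  have hε : ∀ x, ε x = f (ε₁ (e x).1) + l (e x).2 := fun x => rfl
  have hgε : ∀ x, g (ε x) = ε₃ (e x).2 := fun x => by rw [hε, map_add, hgf, hl', zero_add]
  refine ⟨_, ε, fun v => ?_, ModuleCat.of A (LinearMap.ker ε₁), ModuleCat.of A (LinearMap.ker ε₃),
    (e.symm.toLinearMap ∘ₗ LinearMap.inl A _ _).restrict (fun x hx => ?_),
    (LinearMap.snd A _ _ ∘ₗ e.toLinearMap).restrict (fun x hx => ?_), ⟨?_, ?_, ?_⟩, h₁, h₃⟩
  · obtain ⟨y, hy⟩ := hε₃ (g v)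
    obtain ⟨w, hw⟩ := (h.exact (v - l y)).1 (by rw [map_sub, hl', hy, sub_self])
    obtain ⟨z, rfl⟩ := hε₁ w
    exact ⟨e.symm (z, y), by rw [hε, e.apply_symm_apply, hw]; abel⟩
  · have : ε₁ x = 0 := hx
    simp [hε, this]
  · have : ε x = 0 := hx
    change ε₃ (e x).2 = 0
    rw [← hgε, this, map_zero]
  · rintro ⟨x, hx⟩ ⟨y, hy⟩ hxy
    have : e.symm (x, 0) = e.symm (y, 0) := congrArg Subtype.val hxy
    exact Subtype.ext (congrArg Prod.fst (e.symm.injective this))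
  · rintro ⟨x, hx⟩
    have hx' : f (ε₁ (e x).1) + l (e x).2 = 0 := hx
    rw [← Subtype.coe_inj]
    constructor
    · intro h0
      have h0' : (e x).2 = 0 := h0
      rw [h0', map_zero, add_zero] at hx'
      refine ⟨⟨(e x).1, h.injective (by rw [hx', map_zero])⟩, Subtype.ext ?_⟩
      change e.symm ((e x).1, 0) = x
      rw [e.symm_apply_eq, ← h0']
    · rintro ⟨y, hy⟩
      have : e.symm (y.1, 0) = x := congrArg Subtype.val hy
      change (e x).2 = 0
      rw [← this, e.apply_symm_apply]
  · rintro ⟨y, hy⟩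
    have hy' : ε₃ y = 0 := hy
    obtain ⟨w, hw⟩ := (h.exact (l y)).1 (by rw [hl', hy'])
    obtain ⟨z, rfl⟩ := hε₁ w
    -- The element l y lies in the image of f; subtracting a preimage from the first summand moves
    -- the pair into ker ε.
    refine ⟨⟨e.symm (-z, y), ?_⟩, Subtype.ext ?_⟩
    · change ε _ = 0
      rw [hε, e.apply_symm_apply, map_neg, map_neg, hw, neg_add_cancel]
    · change (e (e.symm (-z, y))).2 = y
      rw [e.apply_symm_apply]

/-- A free cover of X₂ also covers X₃. The new kernel is an extension of ker g ≅ X₁ by the old one.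
-/
theorem IsSES.finPresented_right {f : X₁ →ₗ[A] X₂} {g : X₂ →ₗ[A] X₃} (h : IsSES f g)
    (h₁ : FinPresented A ⊤ X₁) (h₂ : FinPresented A ⊤ X₂) : FinPresented A ⊤ X₃ := by
  obtain ⟨m, ε, hε, h₂⟩ := FinPresented.exists_ker (n := ⊤) h₂
  have e : X₁ ≃ₗ[A] LinearMap.ker g := (LinearEquiv.ofInjective f h.injective).trans
    (LinearEquiv.ofEq _ _ h.exact.linearMap_ker_eq.symm)
  refine FinPresented.of_ker (ε := g ∘ₗ ε) (h.surjective.comp hε) ?_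
  refine IsSES.finPresented_mid (X₁ := LinearMap.ker ε) (X₃ := LinearMap.ker g)
    (f := Submodule.inclusion (LinearMap.ker_le_ker_comp _ _))
    (g := ε.restrict fun x hx => hx) ⟨Submodule.inclusion_injective _, ?_, ?_⟩ h₂ (h₁.congr e)
  · rintro ⟨x, hx⟩
    rw [← Subtype.coe_inj]
    exact ⟨fun h0 => ⟨⟨x, h0⟩, rfl⟩, by rintro ⟨⟨y, hy⟩, h0⟩; cases h0; exact hy⟩
  · rintro ⟨x, hx⟩
    obtain ⟨y, rfl⟩ := hε x
    exact ⟨⟨y, hx⟩, rfl⟩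

theorem FinPresented.fin (h : FinPresented A ⊤ X) (m : ℕ) : FinPresented A ⊤ (Fin m → X) := by
  induction m with
  | zero => exact (FinPresented.free 0).congr ⟨0, 0, fun _ => Subsingleton.elim _ _,
      fun _ => Subsingleton.elim _ _⟩
  | succ m ih => exact (IsSES.fin_succ X m).finPresented_mid h ih

/-- Over an `n`-coherent ring, vanishing of `Ext^{m+1}` on finitely `n`-presented modules
propagates to all higher degrees. -/
theorem ext_add_of_isNCoherent {n : ℕ∞} (hA : IsNCoherent A n) {m : ℕ}
    (hY : ∀ U : ModuleCat.{u} A, FinPresented A n U → ExtZero A U Y (m + 1)) (j : ℕ) :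
    ∀ U : ModuleCat.{u} A, FinPresented A n U → ExtZero A U Y (m + j + 1) := by
  induction j with
  | zero => exact hY
  | succ j ih =>
    intro U hU
    obtain ⟨l, ε, hε, hk⟩ := (hA U hU).exists_ker
    exact (IsSES.ker hε).ext_right (ih (ModuleCat.of A _) hk) (.of_projective _)

/-- As ⊤ + 1 = ⊤, dimension shifting on super finitely presented modules needs no assumption on the
ring. -/
theorem isNCoherent_top : IsNCoherent A ⊤ := fun _ h => h

theorem IsSyzygy.finPresented {d : ℕ} (h : IsSyzygy A d X X') : FinPresented A ⊤ X' := by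
  obtain ⟨P, hP⟩ := h
  have h0 : FinPresented A ⊤ (LinearMap.ker P.ε) := ⟨FreePresentation.ker (n := ⊤) P⟩
  have h1 (j : ℕ) : FinPresented A ⊤ (LinearMap.ker (P.d j)) := by
    have hz : ∀ x, P.d j (P.d (j + 1) x) = 0 :=
      (P.exact_succ j (ENat.natCast_lt_top _)).apply_apply_eq_zero
    refine ⟨{
      -- The map d j starts at F_{j+1}, so its kernel is covered by F_{j+2}.
      rank := fun i => P.rank (j + i + 2)
      d := fun i => P.d (j + i + 2)
      ε := (P.d (j + 1)).codRestrict _ hz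
      surjective := fun ⟨x, hx⟩ => by
        obtain ⟨y, hy⟩ := (P.exact_succ j (ENat.natCast_lt_top _) x).1 hx
        exact ⟨y, Subtype.ext hy⟩
      exact_zero := fun h0 x => by
        rw [← Subtype.coe_inj]
        exact P.exact_succ (j + 1) (ENat.natCast_lt_top _) x
      exact_succ := fun i hi => P.exact_succ (j + i + 2) (ENat.natCast_lt_top _) }⟩
  match d, hP with
  | 0, ⟨e⟩ => exact FinPresented.congr e.symm ⟨P⟩
  | 1, ⟨e⟩ => exact h0.congr e.symm
  | j + 2, ⟨e⟩ => exact (h1 j).congr e.symm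

/-- Exactly d short exact sequences with free middle term lie between X' and X, and each costs one
degree. -/
theorem IsSyzygy.ext {d : ℕ} (h : IsSyzygy A d X X')
    (hY : ∀ i, ExtZero A X Y (d + i + 1)) (i : ℕ) : ExtZero A X' Y (i + 1) := by
  obtain ⟨P, hP⟩ := h
  have h0 {i : ℕ} (hi : ExtZero A X Y (i + 1 + 1)) : ExtZero A (LinearMap.ker P.ε) Y (i + 1) :=
    (IsSES.ker P.surjective).ext_left (.of_projective _) hi
  have hs : IsSES (LinearMap.ker (P.d 0)).subtype
      ((P.d 0).codRestrict (LinearMap.ker P.ε)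
        (FreePresentation.ker_ε_apply_d (n := ⊤) P)) :=
    ⟨Subtype.val_injective, fun x => by
      rw [← Subtype.coe_inj]
      exact ⟨fun hx => ⟨⟨x, hx⟩, rfl⟩, by rintro ⟨⟨y, hy⟩, rfl⟩; exact hy⟩,
      fun ⟨x, hx⟩ => by
        obtain ⟨y, hy⟩ := (P.exact_zero (by simp) x).1 hx
        exact ⟨y, Subtype.ext hy⟩⟩
  have hs' (j : ℕ) : IsSES (LinearMap.ker (P.d (j + 1))).subtype
      ((P.d (j + 1)).codRestrict (LinearMap.ker (P.d j))
        (P.exact_succ j (ENat.natCast_lt_top _)).apply_apply_eq_zero) :=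
    ⟨Subtype.val_injective, fun x => by
      rw [← Subtype.coe_inj]
      exact ⟨fun hx => ⟨⟨x, hx⟩, rfl⟩, by rintro ⟨⟨y, hy⟩, rfl⟩; exact hy⟩,
      fun ⟨x, hx⟩ => by
        obtain ⟨y, hy⟩ := (P.exact_succ j (ENat.natCast_lt_top _) x).1 hx
        exact ⟨y, Subtype.ext hy⟩⟩
  have h1 (j : ℕ) : ∀ {i : ℕ}, ExtZero A X Y (j + 2 + i + 1) →
      ExtZero A (LinearMap.ker (P.d j)) Y (i + 1) := by
    induction j with
    | zero =>
      intro i hi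
      rw [show 0 + 2 + i + 1 = i + 1 + 1 + 1 by lia] at hi
      exact hs.ext_left (.of_projective _) (h0 hi)
    | succ j ih =>
      intro i hi
      rw [show j + 1 + 2 + i + 1 = j + 2 + (i + 1) + 1 by lia] at hi
      exact (hs' j).ext_left (.of_projective _) (ih hi)
  have hi := hY i
  match d, hP with
  | 0, ⟨e⟩ => rw [zero_add] at hi; exact hi.congr e.symm (.refl A Y)
  | 1, ⟨e⟩ => exact ExtZero.congr e.symm (.refl A Y) (h0 (by rwa [add_comm 1 i] at hi))
  | j + 2, ⟨e⟩ => exact ExtZero.congr e.symm (.refl A Y) (h1 j hi)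

/-- If `0 → X₀ → X₁ → ⋯` is an exact sequence of super finitely presented modules which are
acyclic for `Hom(-, Y)`, and `Ext^{d+1}(U, Y) = 0` for all super finitely presented `U`, then
`Hom(-, Y)` preserves its exactness. -/
theorem hom_exact_of_coresolution {d : ℕ}
    (hY : ∀ U : ModuleCat.{u} A, FinPresented A ⊤ U → ExtZero A U Y (d + 1))
    (Z : ℕ → Type u) [∀ j, AddCommGroup (Z j)] [∀ j, Module A (Z j)]
    (δ : ∀ j, Z j →ₗ[A] Z (j + 1)) (h0 : Function.Injective (δ 0))
    (hδ : ∀ j, Function.Exact (δ j) (δ (j + 1))) (hZ : ∀ j, FinPresented A ⊤ (Z j))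
    (hZY : ∀ j l, ExtZero A (Z j) Y (l + 1)) :
    (∀ φ : Z 0 →ₗ[A] Y, ∃ ψ : Z 1 →ₗ[A] Y, ψ ∘ₗ δ 0 = φ) ∧
    ∀ (j : ℕ) (φ : Z (j + 1) →ₗ[A] Y), φ ∘ₗ δ j = 0 →
      ∃ ψ : Z (j + 2) →ₗ[A] Y, ψ ∘ₗ δ (j + 1) = φ := by
  let Q : ℕ → Type u := fun j => Z (j + 1) ⧸ LinearMap.range (δ j)
  let p : ∀ j, Z (j + 1) →ₗ[A] Q j := fun j => (LinearMap.range (δ j)).mkQ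
  have hp : ∀ j x, p j x = 0 ↔ x ∈ LinearMap.range (δ j) := fun j x =>
    Submodule.Quotient.mk_eq_zero _
  have s0 : IsSES (δ 0) (p 0) := .range h0
  let q : ∀ j, Q j →ₗ[A] Z (j + 2) := fun j => (LinearMap.range (δ j)).liftQ (δ (j + 1))
    (by rintro _ ⟨x, rfl⟩; exact (hδ j).apply_apply_eq_zero x)
  have hqp : ∀ j x, q j (p j x) = δ (j + 1) x := fun j x => rfl
  -- The sequence breaks into pieces 0 → Q j → Z (j + 2) → Q (j + 1) → 0, starting from `s0`.
  have s1 : ∀ j, IsSES (q j) (p (j + 1)) := fun j => by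
    refine ⟨(injective_iff_map_eq_zero _).2 fun x hx => ?_, fun x => ?_,
      Submodule.mkQ_surjective _⟩
    · obtain ⟨x, rfl⟩ := Submodule.mkQ_surjective _ x
      exact (hp j x).2 ((hδ j x).1 hx)
    · rw [hp]
      constructor
      · rintro ⟨y, rfl⟩; exact ⟨p j y, hqp j y⟩
      · rintro ⟨y, rfl⟩
        obtain ⟨y, rfl⟩ := Submodule.mkQ_surjective _ y
        exact ⟨y, (hqp j y).symm⟩
  have hQ : ∀ j, FinPresented A ⊤ (Q j) := fun j => by
    induction j with
    | zero => exact s0.finPresented_right (hZ 0) (hZ 1)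
    | succ j ih => exact (s1 j).finPresented_right ih (hZ _)
  -- Each passage from Q (j + 1) to Q j lowers the degree by one. The hypothesis gives degree d + 1
  -- for every cokernel, so after d passages degree 1 is reached for every j.
  have hQY : ∀ l, l ≤ d → ∀ j, ExtZero A (Q j) Y (d - l + 1) := fun l => by
    induction l with
    | zero => exact fun _ j => hY (ModuleCat.of A (Q j)) (hQ j)
    | succ l ih =>
      intro hl j
      have := ih (by lia) (j + 1)
      rw [show d - l + 1 = d - (l + 1) + 1 + 1 by lia] at this
      exact (s1 j).ext_left (hZY _ _) this
  have hQ1 : ∀ j, ExtZero A (Q j) Y 1 := fun j => by simpa using hQY d le_rfl j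
  refine ⟨fun φ => s0.exists_extension (hQ1 0) φ, fun j φ hφ => ?_⟩
  obtain ⟨ψ, hψ⟩ : ∃ ψ : Q j →ₗ[A] Y, ψ ∘ₗ p j = φ :=
    ⟨(LinearMap.range (δ j)).liftQ φ (by rintro _ ⟨x, rfl⟩; exact LinearMap.congr_fun hφ x),
      Submodule.liftQ_mkQ _ _ _⟩
  -- The map factors through Q j, which embeds in Z (j + 2) with cokernel Q (j + 1).
  obtain ⟨χ, hχ⟩ := (s1 j).exists_extension (hQ1 (j + 1)) ψ
  refine ⟨χ, ?_⟩
  rw [← hψ, ← hχ]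
  rfl

end FinPresented

/-! ### Character modules over noncommutative rings and `Tor` -/

section Dual

/-- The character group `Hom_ℤ(N, ℚ/ℤ)`. -/
def Dual (N : Type u) [AddCommGroup N] : Type u := N →+ AddCircle (1 : ℚ)

instance (N : Type u) [AddCommGroup N] : AddCommGroup (Dual N) :=
  inferInstanceAs (AddCommGroup (N →+ AddCircle (1 : ℚ)))

instance (N : Type u) [AddCommGroup N] : FunLike (Dual N) N (AddCircle (1 : ℚ)) :=
  inferInstanceAs (FunLike (N →+ AddCircle (1 : ℚ)) N (AddCircle (1 : ℚ)))

instance (N : Type u) [AddCommGroup N] : AddMonoidHomClass (Dual N) N (AddCircle (1 : ℚ)) :=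
  inferInstanceAs (AddMonoidHomClass (N →+ AddCircle (1 : ℚ)) N (AddCircle (1 : ℚ)))

theorem Dual.ext {N : Type u} [AddCommGroup N] {χ ψ : Dual N} (h : ∀ y, χ y = ψ y) : χ = ψ :=
  DFunLike.ext _ _ h

variable {R : Type u} [Ring R]

/-- The character group of a left module is a right module by `(χ r)(y) = χ(r y)`. -/
instance (N : Type u) [AddCommGroup N] [Module R N] : Module Rᵐᵒᵖ (Dual N) where
  smul r χ := AddMonoidHom.comp (χ : N →+ AddCircle (1 : ℚ)) (DistribSMul.toAddMonoidHom N r.unop)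
  one_smul χ := Dual.ext fun y => congrArg χ (one_smul R y)
  mul_smul r r' χ := Dual.ext fun y => congrArg χ (mul_smul r'.unop r.unop y)
  smul_zero _ := rfl
  smul_add _ _ _ := rfl
  add_smul r r' χ := Dual.ext fun y =>
    (congrArg χ (add_smul r.unop r'.unop y)).trans (map_add χ _ _)
  zero_smul χ := Dual.ext fun y => (congrArg χ (zero_smul R y)).trans (map_zero χ)

theorem Dual.smul_apply {N : Type u} [AddCommGroup N] [Module R N] (r : Rᵐᵒᵖ) (χ : Dual N)
    (y : N) : (r • χ) y = χ (r.unop • y) := rfl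

/-! ### Characters detect injectivity and exactness of abelian groups -/

section AddCommGroup

variable {B C D : Type u} [AddCommGroup B] [AddCommGroup C] [AddCommGroup D]

theorem exists_dual_extension {f : B →+ C} (hf : Function.Injective f)
    (χ : B →+ AddCircle (1 : ℚ)) : ∃ ψ : C →+ AddCircle (1 : ℚ), ψ.comp f = χ :=
  CharacterModule.dual_surjective_of_injective f.toIntLinearMap hf χ

theorem exists_dual_ne_zero {x : B} (hx : x ≠ 0) : ∃ χ : B →+ AddCircle (1 : ℚ), χ x ≠ 0 :=
  CharacterModule.exists_character_apply_ne_zero_of_ne_zero hx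

theorem injective_iff_dual {f : B →+ C} : Function.Injective f ↔
    ∀ χ : B →+ AddCircle (1 : ℚ), ∃ ψ : C →+ AddCircle (1 : ℚ), ψ.comp f = χ := by
  refine ⟨fun h => exists_dual_extension h, fun h => (injective_iff_map_eq_zero _).2 fun x hx => ?_⟩
  by_contra hx0
  obtain ⟨χ, hχ⟩ := exists_dual_ne_zero hx0
  obtain ⟨ψ, rfl⟩ := h χ
  exact hχ (by simp [hx])

theorem exact_iff_dual {f : B →+ C} {g : C →+ D} (hgf : g.comp f = 0) : Function.Exact f g ↔
    ∀ χ : C →+ AddCircle (1 : ℚ), χ.comp f = 0 →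
      ∃ ψ : D →+ AddCircle (1 : ℚ), ψ.comp g = χ := by
  constructor
  · intro h χ hχ
    have hk : g.ker ≤ χ.ker := fun x hx => by
      obtain ⟨y, rfl⟩ := (h x).1 hx
      exact DFunLike.congr_fun hχ y
    obtain ⟨ψ, hψ⟩ := exists_dual_extension (QuotientAddGroup.kerLift_injective g)
      (QuotientAddGroup.lift g.ker χ hk)
    refine ⟨ψ, ?_⟩
    ext x
    exact DFunLike.congr_fun hψ (x : C ⧸ g.ker)
  · intro h x
    refine ⟨fun hx => ?_, by rintro ⟨y, rfl⟩; exact DFunLike.congr_fun hgf y⟩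
    by_contra hx0
    have : (x : C ⧸ f.range) ≠ 0 := fun h0 => hx0 ((QuotientAddGroup.eq_zero_iff x).1 h0)
    obtain ⟨χ, hχ⟩ := exists_dual_ne_zero this
    obtain ⟨ψ, hψ⟩ := h (χ.comp (QuotientAddGroup.mk' f.range)) (by
      ext y
      have : ((f y : C) : C ⧸ f.range) = 0 := (QuotientAddGroup.eq_zero_iff _).2 ⟨y, rfl⟩
      simp [this])
    exact hχ ((DFunLike.congr_fun hψ x).symm.trans (by simp [hx]))

end AddCommGroup

variable {U U' U'' N N' N'' : Type u} [AddCommGroup U] [Module Rᵐᵒᵖ U]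
  [AddCommGroup U'] [Module Rᵐᵒᵖ U'] [AddCommGroup U''] [Module Rᵐᵒᵖ U'']
  [AddCommGroup N] [Module R N] [AddCommGroup N'] [Module R N'] [AddCommGroup N''] [Module R N'']

/-- Precomposition, as a map of character modules. -/
def Dual.map (g : N →ₗ[R] N') : Dual N' →ₗ[Rᵐᵒᵖ] Dual N where
  toFun χ := AddMonoidHom.comp (χ : N' →+ AddCircle (1 : ℚ)) g.toAddMonoidHom
  map_add' _ _ := rfl
  map_smul' r χ := Dual.ext fun y => congrArg χ (map_smul g r.unop y).symm

/-- The adjunction `Hom_{Rᵒᵖ}(U, N^*) = (U ⊗_R N)^*`. -/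
def dualCurry : (BTensor R U N →+ AddCircle (1 : ℚ)) ≃ (U →ₗ[Rᵐᵒᵖ] Dual N) where
  toFun χ :=
    { toFun := fun x => (AddMonoidHom.mk' (fun y => χ (BTensor.tmul R x y))
        (fun y y' => by rw [BTensor.tmul_add, map_add]) : N →+ AddCircle (1 : ℚ))
      map_add' := fun x x' => Dual.ext fun y =>
        (congrArg χ (BTensor.add_tmul R x x' y)).trans (map_add χ _ _)
      map_smul' := fun r x => Dual.ext fun y => congrArg χ (BTensor.smul_tmul R x r.unop y) }
  invFun φ := BTensor.lift R φ.toAddMonoidHom fun x r y =>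
    DFunLike.congr_fun (φ.map_smul (MulOpposite.op r) x) y
  left_inv χ := BTensor.addHom_ext R fun _ _ => rfl
  right_inv φ := rfl

theorem dualCurry_comp_left (χ : BTensor R U' N →+ AddCircle (1 : ℚ)) (f : U →ₗ[Rᵐᵒᵖ] U') :
    dualCurry (χ.comp (BTensor.map R f LinearMap.id)) = dualCurry χ ∘ₗ f := rfl

theorem dualCurry_comp_right (χ : BTensor R U N' →+ AddCircle (1 : ℚ)) (g : N →ₗ[R] N') :
    dualCurry (χ.comp (BTensor.map R LinearMap.id g)) = Dual.map g ∘ₗ dualCurry χ := rfl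

theorem dualCurry_zero : dualCurry (0 : BTensor R U N →+ AddCircle (1 : ℚ)) = 0 := rfl

theorem BTensor.map_left_comp (f : U →ₗ[Rᵐᵒᵖ] U') (g : U' →ₗ[Rᵐᵒᵖ] U'') (h : g ∘ₗ f = 0) :
    (BTensor.map R g (LinearMap.id : N →ₗ[R] N)).comp (BTensor.map R f LinearMap.id) = 0 :=
  BTensor.addHom_ext R fun x y => by
    have hx : g (f x) = 0 := LinearMap.congr_fun h x
    have : BTensor.tmul R (0 : U'') y = 0 := by
      simpa using BTensor.add_tmul R (0 : U'') 0 y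
    simpa [hx] using this

theorem BTensor.map_right_comp (f : N →ₗ[R] N') (g : N' →ₗ[R] N'') (h : g ∘ₗ f = 0) :
    (BTensor.map R (LinearMap.id : U →ₗ[Rᵐᵒᵖ] U) g).comp (BTensor.map R LinearMap.id f) = 0 :=
  BTensor.addHom_ext R fun x y => by
    have hy : g (f y) = 0 := LinearMap.congr_fun h y
    have : BTensor.tmul R x (0 : N'') = 0 := by
      simpa using BTensor.tmul_add R x (0 : N'') 0
    simpa [hy] using this

/-- Exactness is tested on characters, and the characters of U ⊗ N are the maps U → N^*. This is how
exactness under Hom(-, N^*) becomes exactness under - ⊗ N. -/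
theorem BTensor.map_left_exact_iff {f : U →ₗ[Rᵐᵒᵖ] U'} {g : U' →ₗ[Rᵐᵒᵖ] U''} (h : g ∘ₗ f = 0) :
    Function.Exact (BTensor.map R f (LinearMap.id : N →ₗ[R] N)) (BTensor.map R g LinearMap.id) ↔
    ∀ φ : U' →ₗ[Rᵐᵒᵖ] Dual N, φ ∘ₗ f = 0 → ∃ ψ : U'' →ₗ[Rᵐᵒᵖ] Dual N, ψ ∘ₗ g = φ := by
  rw [exact_iff_dual (BTensor.map_left_comp f g h), ← dualCurry.forall_congr_right]
  refine forall_congr' fun χ => imp_congr ?_ ?_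
  · rw [← dualCurry_comp_left, ← dualCurry_zero, dualCurry.apply_eq_iff_eq]
  · rw [← dualCurry.exists_congr_right]
    refine exists_congr fun ψ => ?_
    rw [← dualCurry_comp_left, dualCurry.apply_eq_iff_eq]

theorem BTensor.map_left_injective_iff {f : U →ₗ[Rᵐᵒᵖ] U'} :
    Function.Injective (BTensor.map R f (LinearMap.id : N →ₗ[R] N)) ↔
    ∀ φ : U →ₗ[Rᵐᵒᵖ] Dual N, ∃ ψ : U' →ₗ[Rᵐᵒᵖ] Dual N, ψ ∘ₗ f = φ := by
  rw [injective_iff_dual, ← dualCurry.forall_congr_right]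
  refine forall_congr' fun χ => ?_
  rw [← dualCurry.exists_congr_right]
  refine exists_congr fun ψ => ?_
  rw [← dualCurry_comp_left, dualCurry.apply_eq_iff_eq]

theorem IsSES.dual {f : N →ₗ[R] N'} {g : N' →ₗ[R] N''} (h : IsSES f g) :
    IsSES (Dual.map g) (Dual.map f) where
  injective χ ψ hχ := Dual.ext fun y => by
    obtain ⟨y, rfl⟩ := h.surjective y
    exact DFunLike.congr_fun hχ y
  exact χ := by
    have hgf : g.toAddMonoidHom.comp f.toAddMonoidHom = 0 :=
      AddMonoidHom.ext h.exact.apply_apply_eq_zero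
    refine ⟨(exact_iff_dual hgf).1 h.exact χ, ?_⟩
    rintro ⟨ψ, rfl⟩
    exact Dual.ext fun y => (congrArg ψ (h.exact.apply_apply_eq_zero y)).trans (map_zero ψ)
  surjective χ := exists_dual_extension (f := f.toAddMonoidHom) h.injective χ

theorem Dual.subsingleton_iff : Subsingleton (Dual N) ↔ Subsingleton N := by
  constructor
  · intro h
    refine subsingleton_of_forall_eq 0 fun x => ?_
    by_contra hx
    obtain ⟨χ, hχ⟩ := exists_dual_ne_zero hx
    exact hχ (DFunLike.congr_fun (h.elim χ (0 : N →+ _)) x)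
  · intro h
    exact ⟨fun χ ψ => Dual.ext fun y => by rw [Subsingleton.elim y 0, map_zero, map_zero]⟩

/-- `Tor` vanishes if and only if `Ext` into the character module vanishes. -/
theorem tor_succ_iff (i : ℕ) :
    Subsingleton (Tor R (i + 1) U N) ↔ ExtZero Rᵐᵒᵖ U (Dual N) (i + 1) := by
  let P := ProjectiveResolution.of (ModuleCat.of Rᵐᵒᵖ U)
  have hproj (j : ℕ) : Module.Projective Rᵐᵒᵖ (P.complex.X j) :=
    (IsProjective.iff_projective _ ).2 (P.projective j)
  have hε : Function.Surjective (P.π.f 0) := (ModuleCat.epi_iff_surjective _).1 inferInstance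
  have h0 := (ShortComplex.ShortExact.moduleCat_exact_iff_function_exact _).1 P.exact₀
  have hd (j : ℕ) :=
    (ShortComplex.ShortExact.moduleCat_exact_iff_function_exact _).1 (P.exact_succ j)
  have key := ext_succ_iff (Y := Dual N) i (X := U) (fun j => P.complex.X j) (P.π.f 0).hom
    (fun j => (P.complex.d (j + 1) j).hom) hε h0 hd (fun j l => .of_projective l)
  refine Iff.trans ?_ key.symm
  -- One projective resolution serves both sides: the Ext condition is exactness of P ⊗ N in place i
  -- + 1, and the homology there is Tor.
  rw [← BTensor.map_left_exact_iff (hd i).linearMap_comp_eq_zero, Tor,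
    ← AddCommGrpCat.isZero_iff_subsingleton,
    (P.isoLeftDerivedObj (tensorRight R N) (i + 1)).isZero_iff]
  refine Iff.trans (HomologicalComplex.exactAt_iff_isZero_homology _ _).symm ?_
  rw [HomologicalComplex.exactAt_iff' _ (i + 2) (i + 1) i (by simp) (by simp),
    ShortComplex.ab_exact_iff_function_exact]
  rfl

end Dual

/-! ### The complex `Hom_A(F, K)` for a bimodule `K` and a free resolution `F → K` -/

section Bimodule

variable {A B : Type u} [Ring A] [Ring B] {K : Type u} [AddCommGroup K] [Module A K] [Module B K]
  [SMulCommClass A B K]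
variable {F F' : Type u} [AddCommGroup F] [Module A F] [AddCommGroup F'] [Module A F']

/-- Precomposition `Hom_A(F', K) → Hom_A(F, K)`, as a map of `B`-modules. -/
def homPrecomp (B : Type u) [Ring B] (K : Type u) [AddCommGroup K] [Module A K] [Module B K]
    [SMulCommClass A B K] (f : F →ₗ[A] F') : (F' →ₗ[A] K) →ₗ[B] (F →ₗ[A] K) where
  toFun g := g ∘ₗ f
  map_add' _ _ := rfl
  map_smul' _ _ := rfl

/-- The map `K → Hom_A(A^m, K)` sending `k` to `x ↦ x_i k`. -/
def homSingle (A B : Type u) [Ring A] [Ring B] (K : Type u) [AddCommGroup K] [Module A K]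
    [Module B K] [SMulCommClass A B K] {m : ℕ} (i : Fin m) : K →ₗ[B] ((Fin m → A) →ₗ[A] K) where
  toFun k := (LinearMap.toSpanSingleton A K k) ∘ₗ LinearMap.proj i
  map_add' k k' := by ext; simp
  map_smul' b k := by
    ext j
    simp [smul_comm]

theorem homSingle_apply {m : ℕ} (i : Fin m) (k : K) (x : Fin m → A) :
    homSingle A B K i k x = x i • k := rfl

theorem sum_homSingle {m : ℕ} (g : (Fin m → A) →ₗ[A] K) :
    ∑ i, homSingle A B K i (g (Pi.single i 1)) = g := by
  ext j
  simp only [LinearMap.comp_apply, LinearMap.sum_apply, homSingle_apply, LinearMap.single_apply]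
  rw [Finset.sum_eq_single j]
  · simp
  · intro i _ hij
    simp [Pi.single_eq_of_ne hij]
  · simp

/-- The terms of the augmented resolution `⋯ → F_1 → F_0 → X`. -/
def FreePresentation.aug {n : ℕ∞} {X : Type u} [AddCommGroup X] [Module A X]
    (P : FreePresentation A n X) : ℕ → ModuleCat.{u} A
  | 0 => ModuleCat.of A X
  | j + 1 => ModuleCat.of A (Fin (P.rank j) → A)

/-- The maps of the augmented resolution `⋯ → F_1 → F_0 → X`. -/
def FreePresentation.augd {n : ℕ∞} {X : Type u} [AddCommGroup X] [Module A X]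
    (P : FreePresentation A n X) : ∀ j, P.aug (j + 1) →ₗ[A] P.aug j
  | 0 => P.ε
  | j + 1 => P.d j

theorem FreePresentation.augd_exact {X : Type u} [AddCommGroup X] [Module A X]
    (P : FreePresentation A ⊤ X) : ∀ j, Function.Exact (P.augd (j + 1)) (P.augd j)
  | 0 => P.exact_zero (by simp)
  | j + 1 => P.exact_succ j (ENat.natCast_lt_top _)

theorem FreePresentation.ext_succ_iff {X Y : Type u} [AddCommGroup X] [Module A X]
    [AddCommGroup Y] [Module A Y] (P : FreePresentation A ⊤ X) (i : ℕ) :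
    ExtZero A X Y (i + 1) ↔ ∀ φ : P.aug (i + 2) →ₗ[A] Y, φ ∘ₗ P.augd (i + 2) = 0 →
      ∃ ψ : P.aug (i + 1) →ₗ[A] Y, ψ ∘ₗ P.augd (i + 1) = φ :=
  Foxby.ext_succ_iff i (fun j => Fin (P.rank j) → A) P.ε P.d P.surjective
    (P.exact_zero (by simp)) (fun j => P.exact_succ j (ENat.natCast_lt_top _))
    (fun _ l => .of_projective l)

/-- If `F → K` is a resolution by finitely generated free `A`-modules, `Ext_A^i(K, K) = 0` for
`i ≥ 1` and `Hom_A(K, K) = B`, then the exact sequence of `B`-modules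
`0 → Hom_A(K, K) → Hom_A(F_0, K) → Hom_A(F_1, K) → ⋯` remains exact under `Hom_B(-, Y)`, provided
that `Ext_B^i(K, Y) = 0` for `i ≥ 1` and that `Ext_B^{d+1}(U, Y) = 0` for all super finitely
presented modules `U`. -/
theorem FreePresentation.hom_hom_exact (P : FreePresentation A ⊤ K) (hB : FinPresented B ⊤ K)
    (hK : ∀ i, ExtZero A K K (i + 1)) (e : B ≃ₗ[B] (K →ₗ[A] K)) {d : ℕ} {Y : Type u}
    [AddCommGroup Y] [Module B Y]
    (hY : ∀ U : ModuleCat.{u} B, FinPresented B ⊤ U → ExtZero B U Y (d + 1))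
    (hKY : ∀ i, ExtZero B K Y (i + 1)) :
    (∀ φ : (P.aug 0 →ₗ[A] K) →ₗ[B] Y,
      ∃ ψ : (P.aug 1 →ₗ[A] K) →ₗ[B] Y, ψ ∘ₗ homPrecomp B K (P.augd 0) = φ) ∧
    ∀ (j : ℕ) (φ : (P.aug (j + 1) →ₗ[A] K) →ₗ[B] Y), φ ∘ₗ homPrecomp B K (P.augd j) = 0 →
      ∃ ψ : (P.aug (j + 2) →ₗ[A] K) →ₗ[B] Y, ψ ∘ₗ homPrecomp B K (P.augd (j + 1)) = φ := by
  -- Place 0 of the sequence is free of rank one over B; the later places are finite powers of K.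
  have e' (m : ℕ) : (Fin m → K) ≃ₗ[B] ((Fin m → A) →ₗ[A] K) := (Pi.basisFun A (Fin m)).constr B
  have e₀ : (Fin 1 → B) ≃ₗ[B] (K →ₗ[A] K) := (LinearEquiv.funUnique (Fin 1) B B).trans e
  refine hom_exact_of_coresolution hY (fun j => P.aug j →ₗ[A] K)
    (fun j => homPrecomp B K (P.augd j)) (fun g g' h => ?_) (fun j g => ⟨fun hg => ?_, ?_⟩)
    (fun j => ?_) (fun j l => ?_)
  · ext x
    obtain ⟨x, rfl⟩ := P.surjective x
    exact LinearMap.congr_fun h x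
  · have hg' : g ∘ₗ P.augd (j + 1) = 0 := hg
    -- Exactness at the first free module is left exactness of Hom; further on it is the vanishing
    -- of Ext_A(K, K).
    cases j with
    | zero =>
      have hs : IsSES (LinearMap.ker P.ε).subtype P.ε := .ker P.surjective
      refine hs.exists_desc g ?_
      ext ⟨x, hx⟩
      obtain ⟨y, rfl⟩ := (P.augd_exact 0 x).1 hx
      exact LinearMap.congr_fun hg' y
    | succ j => exact (P.ext_succ_iff j).1 (hK j) g hg'
  · rintro ⟨g, rfl⟩
    ext x
    change g (P.augd j (P.augd (j + 1) x)) = 0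
    rw [(P.augd_exact j).apply_apply_eq_zero, map_zero]
  · cases j with
    | zero => exact (FinPresented.free 1).congr e₀
    | succ j => exact (hB.fin _).congr (e' _)
  · cases j with
    | zero => exact ExtZero.congr e₀ (.refl B Y) (.of_projective l)
    | succ j => exact ExtZero.congr (e' _) (.refl B Y) ((hKY l).fin _)

end Bimodule

/-! ### Comparison maps between Hom and tensor products -/

section HomTensor

variable {R S : Type u} [Ring R] [Ring S] {K : Type u} [AddCommGroup K] [Module S K]
  [Module Rᵐᵒᵖ K] [SMulCommClass S Rᵐᵒᵖ K]

theorem BTensor.sum_tmul {U N : Type u} [AddCommGroup U] [Module Rᵐᵒᵖ U] [AddCommGroup N]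
    [Module R N] {ι : Type*} (s : Finset ι) (f : ι → U) (y : N) :
    BTensor.tmul R (∑ i ∈ s, f i) y = ∑ i ∈ s, BTensor.tmul R (f i) y :=
  map_sum (AddMonoidHom.mk' (fun x => BTensor.tmul R x y)
    (fun x x' => BTensor.add_tmul R x x' y)) f s

section

variable (F F' N : Type u) [AddCommGroup F] [Module S F] [AddCommGroup F'] [Module S F']
  [AddCommGroup N] [Module R N]

/-- The natural map `Hom_S(F, K) ⊗_R N → Hom_S(F, K ⊗_R N)`. -/
def homTensor : BTensor R (F →ₗ[S] K) N →+ (F →ₗ[S] BTensor R K N) :=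
  BTensor.lift R
    (AddMonoidHom.mk' (fun g => AddMonoidHom.mk'
      (fun y => ({ toFun := fun x => BTensor.tmul R (g x) y
                   map_add' := fun x x' => by rw [map_add, BTensor.add_tmul]
                   map_smul' := fun s x => by rw [map_smul]; rfl } : F →ₗ[S] BTensor R K N))
      (fun y y' => LinearMap.ext fun x => BTensor.tmul_add R (g x) y y'))
      (fun g g' => AddMonoidHom.ext fun y => LinearMap.ext fun x =>
        BTensor.add_tmul R (g x) (g' x) y))
    (fun g r y => LinearMap.ext fun x => BTensor.smul_tmul R (g x) r y)

variable {F F' N}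

theorem homTensor_tmul (g : F →ₗ[S] K) (y : N) (x : F) :
    homTensor F N (BTensor.tmul R g y) x = BTensor.tmul R (g x) y := rfl

theorem homTensor_precomp (f : F →ₗ[S] F') (t : BTensor R (F' →ₗ[S] K) N) :
    homTensor F N (BTensor.map R (homPrecomp Rᵐᵒᵖ K f) LinearMap.id t) =
      homTensor F' N t ∘ₗ f := by
  induction t using BTensor.induction with
  | zero => simp
  | tmul g y => rfl
  | add a b ha hb => rw [map_add, map_add, ha, hb, map_add, LinearMap.add_comp]

/-- Both sides are m copies of K ⊗ N: a map out of S^m is given by its values on the basis, and the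
inverse spreads these over the coordinate functionals. -/
theorem homTensor_bijective (m : ℕ) :
    Function.Bijective (homTensor (R := R) (S := S) (K := K) (Fin m → S) N) := by
  have h1 (i : Fin m) (t : BTensor R K N) (x : Fin m → S) :
      homTensor (Fin m → S) N (BTensor.map R (homSingle S Rᵐᵒᵖ K i) LinearMap.id t) x =
        x i • t := by
    induction t using BTensor.induction with
    | zero => simp
    | tmul k y => rfl
    | add a b ha hb => rw [map_add, map_add, LinearMap.add_apply, ha, hb, smul_add]
  refine Function.bijective_iff_has_inverse.2 ⟨fun φ => ∑ i, BTensor.map R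
    (homSingle S Rᵐᵒᵖ K i) LinearMap.id (φ (Pi.single i 1)), fun t => ?_, fun φ => ?_⟩
  · induction t using BTensor.induction with
    | zero => simp
    | tmul g y =>
      simp only [homTensor_tmul, BTensor.map_tmul, LinearMap.id_apply]
      rw [← BTensor.sum_tmul, sum_homSingle]
    | add a b ha hb =>
      simp only [map_add, LinearMap.add_apply, Finset.sum_add_distrib] at ha hb ⊢
      rw [ha, hb]
  · ext x
    simp [h1, Pi.single_apply, Finset.mem_univ]

end

variable (R S K) in
-- Lets K be read as a bimodule with the two rings exchanged, so that
-- `FreePresentation.hom_hom_exact` applies on either side.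
theorem smulCommClass_op : SMulCommClass Rᵐᵒᵖ S K := SMulCommClass.symm _ _ _

attribute [local instance] smulCommClass_op

section

variable (G G' I : Type u) [AddCommGroup G] [Module Rᵐᵒᵖ G] [AddCommGroup G'] [Module Rᵐᵒᵖ G']
  [AddCommGroup I] [Module S I]

/-- The natural map `G ⊗_R Hom_S(K, I) → Hom_S(Hom_{Rᵒᵖ}(G, K), I)`. -/
def tensorHom : BTensor R G (BHom S K I) →+ ((G →ₗ[Rᵐᵒᵖ] K) →ₗ[S] I) :=
  BTensor.lift R
    (AddMonoidHom.mk' (fun x => AddMonoidHom.mk'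
      (fun f => ({ toFun := fun g => f (g x)
                   map_add' := fun g g' => map_add f (g x) (g' x)
                   map_smul' := fun s g => map_smul f s (g x) } : (G →ₗ[Rᵐᵒᵖ] K) →ₗ[S] I))
      (fun _ _ => rfl))
      (fun x x' => AddMonoidHom.ext fun f => LinearMap.ext fun g =>
        (congrArg f (map_add g x x')).trans (map_add f _ _)))
    (fun x r f => LinearMap.ext fun g => congrArg f (map_smul g (MulOpposite.op r) x))

variable {G G' I}

theorem tensorHom_precomp (f : G →ₗ[Rᵐᵒᵖ] G') (t : BTensor R G (BHom S K I)) :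
    tensorHom G' I (BTensor.map R f LinearMap.id t) =
      tensorHom G I t ∘ₗ homPrecomp S K f := by
  induction t using BTensor.induction with
  | zero => simp
  | tmul g y => rfl
  | add a b ha hb => rw [map_add, map_add, ha, hb, map_add, LinearMap.add_comp]

/-- The inverse restricts φ to each of the m coordinate copies of K in Hom(G, K) and tensors the
restriction with the matching basis vector. -/
theorem tensorHom_bijective (m : ℕ) :
    Function.Bijective (tensorHom (R := R) (S := S) (K := K) (Fin m → Rᵐᵒᵖ) I) := by
  refine Function.bijective_iff_has_inverse.2 ⟨fun φ => ∑ i, BTensor.tmul R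
    (Pi.single i 1) ((φ ∘ₗ homSingle Rᵐᵒᵖ S K i : K →ₗ[S] I) : BHom S K I), fun t => ?_,
    fun φ => ?_⟩
  · induction t using BTensor.induction with
    | zero =>
      refine Finset.sum_eq_zero fun i _ => ?_
      rw [map_zero, LinearMap.zero_comp]
      exact map_zero (AddMonoidHom.mk' (fun f : BHom S K I => BTensor.tmul R (Pi.single i 1) f)
        (fun f f' => BTensor.tmul_add R _ f f'))
    | tmul x f =>
      have h (i : Fin m) : ((tensorHom (Fin m → Rᵐᵒᵖ) I (BTensor.tmul R x f) ∘ₗ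
          homSingle Rᵐᵒᵖ S K i : K →ₗ[S] I) : BHom S K I) = (x i).unop • f := rfl
      simp only [h, ← BTensor.smul_tmul]
      rw [← BTensor.sum_tmul]
      congr 1
      ext j
      simp [Pi.single_apply]
    | add a b ha hb =>
      refine Eq.trans ?_ (congrArg₂ (· + ·) ha hb)
      refine (Finset.sum_congr rfl fun i _ => ?_).trans Finset.sum_add_distrib
      rw [map_add, LinearMap.add_comp]
      exact BTensor.tmul_add R _ _ _
  · ext g
    rw [map_sum, LinearMap.sum_apply]
    change ∑ i, φ (homSingle Rᵐᵒᵖ S K i (g (Pi.single i 1))) = φ g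
    rw [← map_sum, sum_homSingle]

end

end HomTensor

/-! ### Exactness of the functors `K ⊗_R -` and `Hom_S(K, -)` -/

theorem IsSES.bijective_right {A : Type u} [Ring A] {X₁ X₂ X₃ Y₁ Y₂ Y₃ : Type*}
    [AddCommGroup X₁] [Module A X₁] [AddCommGroup X₂] [Module A X₂] [AddCommGroup X₃] [Module A X₃]
    [AddCommGroup Y₁] [Module A Y₁] [AddCommGroup Y₂] [Module A Y₂] [AddCommGroup Y₃] [Module A Y₃]
    {f : X₁ →ₗ[A] X₂} {g : X₂ →ₗ[A] X₃} {f' : Y₁ →ₗ[A] Y₂} {g' : Y₂ →ₗ[A] Y₃}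
    (h : IsSES f g) (h' : IsSES f' g') {a : X₁ →ₗ[A] Y₁} {b : X₂ →ₗ[A] Y₂} {c : X₃ →ₗ[A] Y₃}
    (hab : ∀ x, b (f x) = f' (a x)) (hbc : ∀ x, c (g x) = g' (b x))
    (ha : Function.Bijective a) (hb : Function.Bijective b) : Function.Bijective c := by
  refine ⟨(injective_iff_map_eq_zero _).2 fun x hx => ?_, fun y => ?_⟩
  · obtain ⟨x, rfl⟩ := h.surjective x
    rw [hbc] at hx
    obtain ⟨y, hy⟩ := (h'.exact _).1 hx
    obtain ⟨z, rfl⟩ := ha.2 y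
    rw [← hab] at hy
    rw [← hb.1 hy]
    exact h.exact.apply_apply_eq_zero z
  · obtain ⟨y, rfl⟩ := h'.surjective y
    obtain ⟨x, rfl⟩ := hb.2 y
    exact ⟨g x, hbc x⟩

theorem IsSES.bijective_left {A : Type u} [Ring A] {X₁ X₂ X₃ Y₁ Y₂ Y₃ : Type*}
    [AddCommGroup X₁] [Module A X₁] [AddCommGroup X₂] [Module A X₂] [AddCommGroup X₃] [Module A X₃]
    [AddCommGroup Y₁] [Module A Y₁] [AddCommGroup Y₂] [Module A Y₂] [AddCommGroup Y₃] [Module A Y₃]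
    {f : X₁ →ₗ[A] X₂} {g : X₂ →ₗ[A] X₃} {f' : Y₁ →ₗ[A] Y₂} {g' : Y₂ →ₗ[A] Y₃}
    (h : IsSES f g) (h' : IsSES f' g') {a : X₁ →ₗ[A] Y₁} {b : X₂ →ₗ[A] Y₂} {c : X₃ →ₗ[A] Y₃}
    (hab : ∀ x, b (f x) = f' (a x)) (hbc : ∀ x, c (g x) = g' (b x))
    (hb : Function.Bijective b) (hc : Function.Bijective c) : Function.Bijective a := by
  refine ⟨fun x y hxy => h.injective (hb.1 (by rw [hab, hab, hxy])), fun y => ?_⟩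
  obtain ⟨x, hx⟩ := hb.2 (f' y)
  have : g x = 0 := hc.1 (by rw [hbc, hx, h'.exact.apply_apply_eq_zero, map_zero])
  obtain ⟨z, rfl⟩ := (h.exact x).1 this
  exact ⟨z, h'.injective (by rw [← hab, hx])⟩

section Functors

variable (R S : Type u) [Ring R] [Ring S] (K : Type u) [AddCommGroup K] [Module S K]
  [Module Rᵐᵒᵖ K] [SMulCommClass S Rᵐᵒᵖ K]

/-- Postcomposition `Hom_S(K, N) → Hom_S(K, N')`. -/
def homMap {N N' : Type u} [AddCommGroup N] [Module S N] [AddCommGroup N'] [Module S N']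
    (g : N →ₗ[S] N') : BHom S K N →ₗ[R] BHom S K N' :=
  ((homFunctor R S K).map (ModuleCat.ofHom g)).hom

/-- The evaluation `M → Hom_S(K, K ⊗_R M)`. -/
def unitMap (M : Type u) [AddCommGroup M] [Module R M] : M →ₗ[R] BHom S K (BTensor R K M) :=
  ((unitEval R S K).app (ModuleCat.of R M)).hom

variable {R S K}

section

variable {N N' N'' : Type u} [AddCommGroup N] [Module S N] [AddCommGroup N'] [Module S N']
  [AddCommGroup N''] [Module S N'']

theorem evalMap_lmap (g : N →ₗ[S] N') (t : BTensor R K (BHom S K N)) :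
    evalMap R S K N' (BTensor.lmap R S K (homMap R S K g) t) = g (evalMap R S K N t) := by
  induction t using BTensor.induction with
  | zero => simp
  | tmul x f => rfl
  | add a b ha hb => rw [map_add, map_add, ha, hb, map_add, map_add]

/-- Only surjectivity can fail for Hom(K, -). It is kept as a hypothesis because in some uses it
comes from μ or from faithfulness and not from Ext^1. -/
theorem IsSES.hom_of_lift {f : N →ₗ[S] N'} {g : N' →ₗ[S] N''} (h : IsSES f g)
    (hs : ∀ φ : K →ₗ[S] N'', ∃ ψ : K →ₗ[S] N', g ∘ₗ ψ = φ) :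
    IsSES (homMap R S K f) (homMap R S K g) where
  injective φ ψ hφ := BHom.ext fun x => h.injective (DFunLike.congr_fun hφ x)
  exact φ := by
    constructor
    · intro hφ
      have hφ' : ∀ x, g (φ x) = 0 := fun x => DFunLike.congr_fun hφ x
      refine ⟨((LinearEquiv.ofInjective f h.injective).symm.toLinearMap ∘ₗ
        LinearMap.codRestrict (LinearMap.range f) (φ : K →ₗ[S] N')
          (fun x => (h.exact _).1 (hφ' x)) : K →ₗ[S] N), BHom.ext fun x => ?_⟩
      exact congrArg Subtype.val ((LinearEquiv.ofInjective f h.injective).apply_symm_apply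
        ⟨φ x, (h.exact _).1 (hφ' x)⟩)
    · rintro ⟨ψ, rfl⟩
      exact BHom.ext fun x => h.exact.apply_apply_eq_zero (ψ x)
  surjective φ := hs φ

end

section

variable {M M' M'' : Type u} [AddCommGroup M] [Module R M] [AddCommGroup M'] [Module R M']
  [AddCommGroup M''] [Module R M'']

theorem unitMap_map (g : M →ₗ[R] M') (y : M) :
    unitMap R S K M' (g y) = homMap R S K (BTensor.lmap R S K g) (unitMap R S K M y) := rfl

theorem BTensor.lmap_comp (f : M →ₗ[R] M') (g : M' →ₗ[R] M'') (t : BTensor R K M) :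
    lmap R S K g (lmap R S K f t) = lmap R S K (g ∘ₗ f) t := by
  induction t using BTensor.induction with
  | zero => simp
  | tmul x y => rfl
  | add a b ha hb => simp only [map_add, ha, hb]

theorem BTensor.lmap_zero (t : BTensor R K M) : lmap R S K (0 : M →ₗ[R] M') t = 0 := by
  induction t using BTensor.induction with
  | zero => simp
  | tmul x y => simpa using BTensor.tmul_add R x (0 : M') 0
  | add a b ha hb => rw [map_add, ha, hb, add_zero]

theorem BTensor.lmap_surjective {g : M →ₗ[R] M'} (hg : Function.Surjective g) :
    Function.Surjective (lmap R S K g) := fun t => by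
  induction t using BTensor.induction with
  | zero => exact ⟨0, map_zero _⟩
  | tmul x y =>
    obtain ⟨y, rfl⟩ := hg y
    exact ⟨tmul R x y, rfl⟩
  | add a b ha hb =>
    obtain ⟨a, rfl⟩ := ha
    obtain ⟨b, rfl⟩ := hb
    exact ⟨a + b, map_add _ _ _⟩

/-- By adjunction, a character of K ⊗ M extends to K ⊗ M' exactly when the corresponding map K → M^*
lifts to M'^*. Both directions are used: Ext^1 gives injectivity, and injectivity gives back Ext^1.
-/
theorem BTensor.lmap_injective_iff {f : M →ₗ[R] M'} : Function.Injective (lmap R S K f) ↔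
    ∀ φ : K →ₗ[Rᵐᵒᵖ] Dual M, ∃ ψ : K →ₗ[Rᵐᵒᵖ] Dual M', Dual.map f ∘ₗ ψ = φ := by
  change Function.Injective (BTensor.map R LinearMap.id f) ↔ _
  rw [injective_iff_dual, ← dualCurry.forall_congr_right]
  refine forall_congr' fun χ => ?_
  rw [← dualCurry.exists_congr_right]
  refine exists_congr fun ψ => ?_
  rw [← dualCurry_comp_right, dualCurry.apply_eq_iff_eq]

/-- Right exactness of K ⊗ -, seen on characters as left exactness of Hom(K, -) on the dual
sequence. -/
theorem IsSES.tensor_of_injective {f : M →ₗ[R] M'} {g : M' →ₗ[R] M''} (h : IsSES f g)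
    (hi : Function.Injective (BTensor.lmap R S K f)) :
    IsSES (BTensor.lmap R S K f) (BTensor.lmap R S K g) where
  injective := hi
  exact := by
    refine (exact_iff_dual (BTensor.map_right_comp f g
      h.exact.linearMap_comp_eq_zero)).2 fun χ hχ => ?_
    have hφ : Dual.map f ∘ₗ dualCurry χ = 0 := by
      rw [← dualCurry_comp_right, hχ, dualCurry_zero]
    have hd := h.dual
    have hr : ∀ x, dualCurry χ x ∈ LinearMap.range (Dual.map g) := fun x =>
      (hd.exact _).1 (LinearMap.congr_fun hφ x)
    refine ⟨dualCurry.symm ((LinearEquiv.ofInjective _ hd.injective).symm.toLinearMap ∘ₗ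
      LinearMap.codRestrict _ (dualCurry χ) hr), dualCurry.injective ?_⟩
    rw [dualCurry_comp_right, Equiv.apply_symm_apply]
    ext x : 1
    exact congrArg Subtype.val ((LinearEquiv.ofInjective _ hd.injective).apply_symm_apply
        ⟨dualCurry χ x, hr x⟩)
  surjective := BTensor.lmap_surjective h.surjective

theorem IsSES.tensor_of_ext {f : M →ₗ[R] M'} {g : M' →ₗ[R] M''} (h : IsSES f g)
    (hK : ExtZero Rᵐᵒᵖ K (Dual M'') 1) : IsSES (BTensor.lmap R S K f) (BTensor.lmap R S K g) :=
  h.tensor_of_injective (BTensor.lmap_injective_iff.2 fun φ => h.dual.exists_lift hK φ)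

theorem IsSES.hom_of_ext {N N' N'' : Type u} [AddCommGroup N] [Module S N] [AddCommGroup N']
    [Module S N'] [AddCommGroup N''] [Module S N''] {f : N →ₗ[S] N'} {g : N' →ₗ[S] N''}
    (h : IsSES f g) (hK : ExtZero S K N 1) :
    IsSES (homMap R S K f) (homMap R S K g) :=
  h.hom_of_lift fun φ => h.exists_lift hK φ

/-- Character modules of isomorphic modules are isomorphic. -/
def Dual.congr (e : M ≃ₗ[R] M') : Dual M ≃ₗ[Rᵐᵒᵖ] Dual M' :=
  { Dual.map e.symm.toLinearMap with
    invFun := Dual.map e.toLinearMap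
    left_inv := fun χ => Dual.ext fun y => congrArg χ (e.symm_apply_apply y)
    right_inv := fun χ => Dual.ext fun y => congrArg χ (e.apply_symm_apply y) }

end

/-! ### The Auslander and Bass classes -/

theorem forall_one_le_iff {p : ℕ → Prop} : (∀ i, 1 ≤ i → p i) ↔ ∀ i, p (i + 1) :=
  ⟨fun h i => h _ (by lia), fun h i hi => by
    obtain ⟨i, rfl⟩ := Nat.exists_eq_add_of_le' hi
    exact h i⟩

theorem auslanderClass_iff {M : ModuleCat.{u} R} : auslanderClass R S K M ↔
    (∀ i, ExtZero Rᵐᵒᵖ K (Dual M) (i + 1)) ∧ (∀ i, ExtZero S K (BTensor R K M) (i + 1)) ∧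
      Function.Bijective (unitMap R S K M) := by
  rw [auslanderClass, forall_one_le_iff, forall_one_le_iff, ConcreteCategory.isIso_iff_bijective]
  simp only [tor_succ_iff]
  rfl

theorem bassClass_iff {N : ModuleCat.{u} S} : bassClass R S K N ↔
    (∀ i, ExtZero S K N (i + 1)) ∧ (∀ i, ExtZero Rᵐᵒᵖ K (Dual (BHom S K N)) (i + 1)) ∧
      Function.Bijective (evalMap R S K N) := by
  rw [bassClass, forall_one_le_iff, forall_one_le_iff, ConcreteCategory.isIso_iff_bijective]
  simp only [tor_succ_iff]
  rfl

/-! ### Two-out-of-three properties of the Auslander and Bass classes -/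

section Closure

variable {M M' M'' : ModuleCat.{u} R} {f : M →ₗ[R] M'} {g : M' →ₗ[R] M''}
  {N N' N'' : ModuleCat.{u} S} {p : N →ₗ[S] N'} {q : N' →ₗ[S] N''}

/-- Faithfulness on the right, applied to L^*: the group Hom(K, L^*) is the character group of K ⊗
L. -/
theorem IsFaithfullySemidualizing.subsingleton_of_tensor (hK : IsFaithfullySemidualizing R S K)
    (L : Type u) [AddCommGroup L] [Module R L] (hL : Subsingleton (BTensor R K L)) :
    Subsingleton L := by
  rw [← Dual.subsingleton_iff]
  refine hK.faithful_right (ModuleCat.of Rᵐᵒᵖ (Dual L)) ?_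
  refine (dualCurry (R := R) (U := K) (N := L)).symm.subsingleton_congr.2 ⟨fun χ ψ => ?_⟩
  ext t
  rw [Subsingleton.elim t 0, map_zero, map_zero]

/-- The point is that K ⊗ M → K ⊗ M' is injective. A map from K into its kernel has the form x ↦ x ⊗
y because μ_M is onto; injectivity of μ_{M'} and of f forces y = 0. So the kernel receives no
nonzero map from K and vanishes by faithfulness. -/
theorem IsSES.auslanderClass_right (hK : IsFaithfullySemidualizing R S K) (h : IsSES f g)
    (h₁ : auslanderClass R S K M) (h₂ : auslanderClass R S K M') : auslanderClass R S K M'' := by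
  rw [auslanderClass_iff] at *
  obtain ⟨a₁, b₁, c₁⟩ := h₁
  obtain ⟨a₂, b₂, c₂⟩ := h₂
  have hi : Function.Injective (BTensor.lmap R S K f) := by
    rw [← LinearMap.ker_eq_bot, ← Submodule.subsingleton_iff_eq_bot]
    refine hK.faithful_left (ModuleCat.of S (LinearMap.ker (BTensor.lmap R S K f)))
      (subsingleton_of_forall_eq 0 fun φ => ?_)
    obtain ⟨y, hy⟩ := c₁.2 ((LinearMap.ker (BTensor.lmap R S K f)).subtype ∘ₗ φ :
      K →ₗ[S] BTensor R K M)
    have hy' : ∀ x, BTensor.tmul R x y = (φ x : BTensor R K M) := DFunLike.congr_fun hy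
    have : unitMap R S K M' (f y) = 0 := BHom.ext fun x => by
      change BTensor.lmap R S K f (BTensor.tmul R x y) = 0
      rw [hy']
      exact (φ x).2
    have hy0 : y = 0 := h.injective (c₂.1 (by rw [this, map_zero, map_zero]))
    ext x : 1
    refine Subtype.ext ?_
    rw [← hy', hy0]
    exact DFunLike.congr_fun (map_zero (unitMap R S K M)) x
  have ht := h.tensor_of_injective hi
  have hh := ht.hom_of_ext (R := R) (b₁ 0)
  refine ⟨fun i => ?_, fun i => ht.coext_right (b₁ (i + 1)) (b₂ i),
    h.bijective_right hh (unitMap_map f) (unitMap_map g) c₁ c₂⟩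
  cases i with
  | zero => exact h.dual.coext_one (a₂ 0) (BTensor.lmap_injective_iff.1 hi)
  | succ i => exact h.dual.coext_left (a₂ (i + 1)) (a₁ i)

/-- No faithfulness is needed: Tor_1(K, M'') = 0 keeps the tensored sequence exact. A map K → K ⊗
M'' is μ of some element, which lifts along g. -/
theorem IsSES.auslanderClass_left (h : IsSES f g)
    (h₂ : auslanderClass R S K M') (h₃ : auslanderClass R S K M'') : auslanderClass R S K M := by
  rw [auslanderClass_iff] at *
  obtain ⟨a₂, b₂, c₂⟩ := h₂
  obtain ⟨a₃, b₃, c₃⟩ := h₃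
  have ht := h.tensor_of_ext (S := S) (a₃ 0)
  have hl : ∀ φ : K →ₗ[S] BTensor R K M'', ∃ ψ, BTensor.lmap R S K g ∘ₗ ψ = φ := fun φ => by
    obtain ⟨z, rfl⟩ := c₃.2 φ
    obtain ⟨y, rfl⟩ := h.surjective z
    exact ⟨unitMap R S K M' y, (unitMap_map g y).symm⟩
  refine ⟨fun i => h.dual.coext_right (a₃ (i + 1)) (a₂ i), fun i => ?_,
    h.bijective_left (ht.hom_of_lift hl) (unitMap_map f) (unitMap_map g) c₂ c₃⟩
  cases i with
  | zero => exact ht.coext_one (b₂ 0) hl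
  | succ i => exact ht.coext_left (b₂ (i + 1)) (b₃ i)

/-- The point is that Hom(K, q) is surjective. After K ⊗ - it is, being identified with q by ν; so
its cokernel L has K ⊗ L = 0, and faithfulness gives L = 0. -/
theorem IsSES.bassClass_left (hK : IsFaithfullySemidualizing R S K) (h : IsSES p q)
    (h₂ : bassClass R S K N') (h₃ : bassClass R S K N'') : bassClass R S K N := by
  rw [bassClass_iff] at *
  obtain ⟨a₂, b₂, c₂⟩ := h₂
  obtain ⟨a₃, b₃, c₃⟩ := h₃
  have hl : Function.Surjective (homMap R S K q) := by
    have hs : Function.Surjective (BTensor.lmap R S K (homMap R S K q)) := fun t => by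
      obtain ⟨y, hy⟩ := h.surjective (evalMap R S K N'' t)
      obtain ⟨t', rfl⟩ := c₂.2 y
      exact ⟨t', c₃.1 (by rw [evalMap_lmap, hy])⟩
    rw [← LinearMap.range_eq_top, ← Submodule.Quotient.subsingleton_iff]
    refine hK.subsingleton_of_tensor _ (subsingleton_of_forall_eq 0 fun t => ?_)
    obtain ⟨t, rfl⟩ := BTensor.lmap_surjective (S := S) (Submodule.mkQ_surjective _) t
    obtain ⟨t, rfl⟩ := hs t
    rw [BTensor.lmap_comp, LinearMap.range_mkQ_comp, BTensor.lmap_zero]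
  have hh := h.hom_of_lift (R := R) (K := K) hl
  have ht := hh.tensor_of_ext (S := S) (b₃ 0)
  refine ⟨fun i => ?_, fun i => hh.dual.coext_right (b₃ (i + 1)) (b₂ i),
    ht.bijective_left h (evalMap_lmap p) (evalMap_lmap q) c₂ c₃⟩
  cases i with
  | zero => exact h.coext_one (a₂ 0) hl
  | succ i => exact h.coext_left (a₂ (i + 1)) (a₃ i)

/-- Here Ext^1(K, N) = 0 keeps Hom(K, -) exact, and K ⊗ Hom(K, p) is injective because ν turns it
into p. -/
theorem IsSES.bassClass_right (h : IsSES p q)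
    (h₁ : bassClass R S K N) (h₂ : bassClass R S K N') : bassClass R S K N'' := by
  rw [bassClass_iff] at *
  obtain ⟨a₁, b₁, c₁⟩ := h₁
  obtain ⟨a₂, b₂, c₂⟩ := h₂
  have hh := h.hom_of_ext (R := R) (a₁ 0)
  have hi : Function.Injective (BTensor.lmap R S K (homMap R S K p)) := fun t t' htt => by
    refine c₁.1 (h.injective ?_)
    rw [← evalMap_lmap, htt, evalMap_lmap]
  have ht := hh.tensor_of_injective hi
  refine ⟨fun i => h.coext_right (a₁ (i + 1)) (a₂ i), fun i => ?_,
    ht.bijective_right h (fun t => (evalMap_lmap p t)) (fun t => (evalMap_lmap q t)) c₁ c₂⟩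
  cases i with
  | zero => exact hh.dual.coext_one (b₂ 0) (BTensor.lmap_injective_iff.1 hi)
  | succ i => exact hh.dual.coext_left (b₂ (i + 1)) (b₁ i)

end Closure

end Functors

/-! ### `(n,d)`-flat modules are Auslander, `(n,d)`-injective modules are Bass -/

section ND

theorem IsSyzygy.ext_of_forall_finPresented {A : Type u} [Ring A] {C K Y : Type u}
    [AddCommGroup C] [Module A C] [AddCommGroup K] [Module A K] [AddCommGroup Y] [Module A Y]
    {d : ℕ} (h : IsSyzygy A d C K)
    (hY : ∀ U : ModuleCat.{u} A, FinPresented A ⊤ U → ExtZero A U Y (d + 1)) (i : ℕ) :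
    ExtZero A K Y (i + 1) :=
  have hC : FinPresented A ⊤ C := h.elim fun P _ => ⟨P⟩
  h.ext (fun j => ext_add_of_isNCoherent isNCoherent_top hY j (ModuleCat.of A C) hC) i

variable {R S : Type u} [Ring R] [Ring S] {K : Type u} [AddCommGroup K] [Module S K]
  [Module Rᵐᵒᵖ K] [SMulCommClass S Rᵐᵒᵖ K] {C : Type u} [AddCommGroup C] [Module S C]
  [Module Rᵐᵒᵖ C] [SMulCommClass S Rᵐᵒᵖ C] {n : ℕ∞} {d : ℕ}

attribute [local instance] smulCommClass_op

theorem ndFlat_iff {N : ModuleCat.{u} R} : ndFlat R n d N ↔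
    ∀ U : ModuleCat.{u} Rᵐᵒᵖ, FinPresented Rᵐᵒᵖ n U → ExtZero Rᵐᵒᵖ U (Dual N) (d + 1) :=
  forall₂_congr fun _ _ => tor_succ_iff d

/-- The isomorphism `R ≅ Hom_S(K, K)` of right `R`-modules. -/
noncomputable def IsSemidualizing.rightEquiv (h : IsSemidualizing R S K) :
    Rᵐᵒᵖ ≃ₗ[Rᵐᵒᵖ] (K →ₗ[S] K) :=
  LinearEquiv.ofBijective (LinearMap.toSpanSingleton Rᵐᵒᵖ (K →ₗ[S] K) LinearMap.id)
    (h.b₂.comp MulOpposite.unop_bijective)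

/-- The isomorphism `S ≅ Hom_{Rᵒᵖ}(K, K)` of left `S`-modules. -/
noncomputable def IsSemidualizing.leftEquiv (h : IsSemidualizing R S K) :
    S ≃ₗ[S] (K →ₗ[Rᵐᵒᵖ] K) :=
  LinearEquiv.ofBijective (LinearMap.toSpanSingleton S (K →ₗ[Rᵐᵒᵖ] K) LinearMap.id) h.b₁

/-- This is R ⊗ N = N read through R ≅ Hom_S(K, K); it turns the comparison map at K into μ_N. -/
theorem IsSemidualizing.tmul_id_bijective (h : IsSemidualizing R S K) (N : Type u) [AddCommGroup N]
    [Module R N] :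
    Function.Bijective fun y : N => BTensor.tmul R (LinearMap.id : K →ₗ[S] K) y := by
  let e := h.rightEquiv
  have he (r : Rᵐᵒᵖ) : e r = r • LinearMap.id := rfl
  let l : BTensor R (K →ₗ[S] K) N →+ N := BTensor.lift R
    (AddMonoidHom.mk' (fun g => AddMonoidHom.mk' (fun y => (e.symm g).unop • y) (smul_add _))
      (fun g g' => AddMonoidHom.ext fun y => by simp [add_smul]))
    (fun g r y => by simp [mul_smul])
  have hl (y : N) : l (BTensor.tmul R LinearMap.id y) = y := by
    have : e.symm LinearMap.id = 1 := by rw [e.symm_apply_eq, he, one_smul]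
    simp [l, this]
  refine ⟨Function.LeftInverse.injective hl, fun t => ?_⟩
  induction t using BTensor.induction with
  | zero => exact ⟨0, map_zero (AddMonoidHom.mk'
      (fun y : N => BTensor.tmul R (LinearMap.id : K →ₗ[S] K) y) (BTensor.tmul_add R _))⟩
  | tmul g y =>
    obtain ⟨r, rfl⟩ := e.surjective g
    exact ⟨r.unop • y, (BTensor.smul_tmul R LinearMap.id r.unop y).symm⟩
  | add a b ha hb =>
    obtain ⟨a, rfl⟩ := ha
    obtain ⟨b, rfl⟩ := hb
    exact ⟨a + b, BTensor.tmul_add R _ a b⟩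

theorem IsSemidualizing.eval_id_bijective (h : IsSemidualizing R S K) (I : Type u) [AddCommGroup I]
    [Module S I] :
    Function.Bijective fun φ : (K →ₗ[Rᵐᵒᵖ] K) →ₗ[S] I => φ LinearMap.id := by
  let e := h.leftEquiv
  have he (s : S) : e s = s • LinearMap.id := rfl
  refine ⟨fun φ ψ hφ => LinearMap.ext fun g => ?_, fun y =>
    ⟨LinearMap.toSpanSingleton S I y ∘ₗ e.symm.toLinearMap, ?_⟩⟩
  · obtain ⟨s, rfl⟩ := e.surjective g
    have hφ' : φ LinearMap.id = ψ LinearMap.id := hφ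
    rw [he, map_smul, map_smul, hφ']
  · have : e.symm LinearMap.id = 1 := by rw [e.symm_apply_eq, he, one_smul]
    simp [this]

/-- With P a free resolution of K over S, the sequence Hom(P, K) ⊗ N is exact and agrees with Hom(P,
K ⊗ N) on the free terms. -/
theorem ndFlat_le_auslanderClass (hK : IsSpecialFaithfullySemidualizing R S K d C) :
    ndFlat R n d ≤ auslanderClass R S K := by
  intro N hN
  rw [ndFlat_iff] at hN
  have hY : ∀ U : ModuleCat.{u} Rᵐᵒᵖ, FinPresented Rᵐᵒᵖ ⊤ U → ExtZero Rᵐᵒᵖ U (Dual N) (d + 1) :=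
    fun U hU => hN U (hU.of_top n)
  have hKN := hK.syzygy_right.ext_of_forall_finPresented hY
  obtain ⟨P⟩ := hK.syzygy_left.finPresented
  obtain ⟨h0, h1⟩ := P.hom_hom_exact hK.syzygy_right.finPresented
    (fun i => hK.c₁ (i + 1) (by lia)) hK.rightEquiv hY hKN
  have hz (j : ℕ) : homPrecomp Rᵐᵒᵖ K (P.augd (j + 1)) ∘ₗ homPrecomp Rᵐᵒᵖ K (P.augd j) = 0 := by
    ext g x
    change g (P.augd j (P.augd (j + 1) x)) = 0
    rw [(P.augd_exact j).apply_apply_eq_zero, map_zero]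
  have hi := BTensor.map_left_injective_iff.2 h0
  have hex (j : ℕ) := (BTensor.map_left_exact_iff (hz j)).2 (h1 j)
  have hb (j : ℕ) : Function.Bijective (homTensor (R := R) (S := S) (K := K) (P.aug (j + 1)) N) :=
    homTensor_bijective (P.rank j)
  -- A cocycle with values in K ⊗ N comes from the exact complex Hom(P, K) ⊗ N one place earlier.
  -- For j = 0 that place is Hom(K, K) ⊗ N.
  have hlift (j : ℕ) (φ : P.aug (j + 1) →ₗ[S] BTensor R K N) (hφ : φ ∘ₗ P.augd (j + 1) = 0) :
      ∃ t : BTensor R (P.aug j →ₗ[S] K) N,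
        homTensor _ N (BTensor.map R (homPrecomp Rᵐᵒᵖ K (P.augd j)) LinearMap.id t) = φ := by
    obtain ⟨t, rfl⟩ := (hb j).2 φ
    obtain ⟨t', ht'⟩ := (hex j t).1 ((hb (j + 1)).1 (by
      rw [map_zero, homTensor_precomp, hφ]))
    exact ⟨t', by rw [ht']⟩
  rw [auslanderClass_iff]
  refine ⟨hKN, fun i => (P.ext_succ_iff i).2 fun φ hφ => ?_, ?_⟩
  · obtain ⟨t, ht⟩ := hlift (i + 1) φ hφ
    exact ⟨homTensor _ N t, by rw [← ht, homTensor_precomp]⟩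
  · have hθ : Function.Bijective (homTensor (R := R) (S := S) (K := K) (P.aug 0) N) := by
      refine ⟨(injective_iff_map_eq_zero _).2 fun t ht => ?_, fun φ => ?_⟩
      · refine hi ((hb 0).1 ?_)
        rw [map_zero, map_zero, homTensor_precomp, ht, LinearMap.zero_comp]
      · obtain ⟨t, ht⟩ := hlift 0 (φ ∘ₗ P.ε) (by
          ext x : 1
          exact (congrArg φ (FreePresentation.ker_ε_apply_d (n := ⊤) P x)).trans (map_zero φ))
        refine ⟨t, LinearMap.ext fun x => ?_⟩
        obtain ⟨x, rfl⟩ := P.surjective x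
        exact LinearMap.congr_fun ((homTensor_precomp P.ε t).symm.trans ht) x
    exact hθ.comp (hK.tmul_id_bijective N)

/-- With P a free resolution of K over Rᵐᵒᵖ, the complex P ⊗ Hom(K, I) agrees on the free terms with
Hom(Hom(P, K), I), which is exact. -/
theorem ndInjective_le_bassClass (hK : IsSpecialFaithfullySemidualizing R S K d C) :
    ndInjective S n d ≤ bassClass R S K := by
  intro I hI
  have hY : ∀ U : ModuleCat.{u} S, FinPresented S ⊤ U → ExtZero S U I (d + 1) :=
    fun U hU => hI U (hU.of_top n)
  have hKI := hK.syzygy_left.ext_of_forall_finPresented hY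
  obtain ⟨P⟩ := hK.syzygy_right.finPresented
  obtain ⟨h0, h1⟩ := P.hom_hom_exact hK.syzygy_left.finPresented
    (fun i => hK.c₂ (i + 1) (by lia)) hK.leftEquiv hY hKI
  have hb (j : ℕ) : Function.Bijective (tensorHom (R := R) (S := S) (K := K) (P.aug (j + 1)) I) :=
    tensorHom_bijective (P.rank j)
  have hlift (j : ℕ) (t : BTensor R (P.aug (j + 1)) (BHom S K I))
      (ht : tensorHom _ I (BTensor.map R (P.augd j) LinearMap.id t) = 0) :
      ∃ t', BTensor.map R (P.augd (j + 1)) LinearMap.id t' = t := by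
    obtain ⟨ψ, hψ⟩ := h1 j (tensorHom _ I t) (by rw [← tensorHom_precomp, ht])
    obtain ⟨t', rfl⟩ := (hb (j + 1)).2 ψ
    exact ⟨t', (hb j).1 (by rw [← hψ, tensorHom_precomp])⟩
  have hz (j : ℕ) : P.augd j ∘ₗ P.augd (j + 1) = 0 := (P.augd_exact j).linearMap_comp_eq_zero
  rw [bassClass_iff]
  refine ⟨hKI, fun i => (P.ext_succ_iff i).2 ?_, ?_⟩
  · rw [← BTensor.map_left_exact_iff (hz (i + 1))]
    intro t
    refine ⟨fun ht => hlift (i + 1) t (by rw [ht, map_zero]), ?_⟩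
    rintro ⟨t, rfl⟩
    exact DFunLike.congr_fun (BTensor.map_left_comp _ _ (hz (i + 1))) t
  · have hs : Function.Surjective (BTensor.map R (P.augd 0) (LinearMap.id : BHom S K I →ₗ[R] _)) := by
      intro t
      induction t using BTensor.induction with
      | zero => exact ⟨0, map_zero _⟩
      | tmul x f =>
        obtain ⟨x, rfl⟩ := P.surjective x
        exact ⟨BTensor.tmul R x f, rfl⟩
      | add a b ha hb =>
        obtain ⟨a, rfl⟩ := ha
        obtain ⟨b, rfl⟩ := hb
        exact ⟨a + b, map_add _ _ _⟩
    -- Both sides are the cokernel of the same map between the first two free terms.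
    have hθ : Function.Bijective (tensorHom (R := R) (S := S) (K := K) K I) := by
      refine ⟨(injective_iff_map_eq_zero _).2 fun t ht => ?_, fun φ => ?_⟩
      · obtain ⟨t, rfl⟩ := hs t
        obtain ⟨t, rfl⟩ := hlift 0 t ht
        exact DFunLike.congr_fun (BTensor.map_left_comp _ _ (hz 0)) t
      · obtain ⟨ψ, rfl⟩ := h0 φ
        obtain ⟨t, rfl⟩ := (hb 0).2 ψ
        exact ⟨_, tensorHom_precomp P.ε t⟩
    -- ν_I is the comparison map at K followed by evaluation at the identity of K.
    convert (hK.eval_id_bijective I).comp hθ using 1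
    funext t
    induction t using BTensor.induction with
    | zero => simp
    | tmul x f => rfl
    | add a b ha hb =>
      rw [map_add, ha, hb]
      simp

end ND

/-! ### Finite resolutions and coresolutions -/

section Resolution

variable {A : Type u} [Ring A] {X : ObjectProperty (ModuleCat.{u} A)} {k : ℕ} {M : ModuleCat.{u} A}

theorem resolutionLE_zero [X.IsClosedUnderIsomorphisms] : resolutionLE X 0 M ↔ X M := by
  constructor
  · rintro ⟨F, ε, d, hX, h0, hε, hd, -⟩
    have := h0 1 (by lia)
    have hi : Function.Injective ε := (injective_iff_map_eq_zero ε.hom).2 fun x hx => by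
      obtain ⟨y, rfl⟩ := (hd x).1 hx
      rw [Subsingleton.elim y 0]
      exact map_zero (d 0).hom
    exact X.prop_of_iso (LinearEquiv.ofBijective ε.hom ⟨hi, hε⟩).toModuleIso (hX 0 le_rfl)
  · intro h
    refine ⟨fun i => Nat.casesOn i M fun _ => ModuleCat.of A PUnit, 𝟙 M, fun _ => 0, ?_, ?_,
      fun x => ⟨x, rfl⟩, fun x => ?_, fun i x => ?_⟩
    · rintro i hi
      obtain rfl : i = 0 := by lia
      exact h
    · rintro (_ | i) hi
      · lia
      · exact inferInstanceAs (Subsingleton PUnit)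
    · constructor
      · intro h; exact ⟨0, h.symm⟩
      · rintro ⟨y, rfl⟩; rfl
    · exact ⟨fun _ => ⟨0, Subsingleton.elim (α := PUnit) _ _⟩, fun _ => rfl⟩

/-- Splitting off the term next to M reduces statements about finite resolutions to an induction
over short exact sequences. -/
theorem resolutionLE_succ : resolutionLE X (k + 1) M ↔
    ∃ (M' F : ModuleCat.{u} A) (f : M' →ₗ[A] F) (g : F →ₗ[A] M),
      IsSES f g ∧ X F ∧ resolutionLE X k M' := by
  constructor
  · rintro ⟨F, ε, d, hX, h0, hε, hd, hd'⟩
    refine ⟨ModuleCat.of A (LinearMap.ker ε.hom), F 0, _, ε.hom, .ker hε, hX 0 (by lia),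
      fun i => F (i + 1), ModuleCat.ofHom ((d 0).hom.codRestrict _ hd.apply_apply_eq_zero),
      fun i => d (i + 1), fun i hi => hX _ (by lia), fun i hi => h0 _ (by lia), ?_, fun x => ?_,
      fun i => hd' (i + 1)⟩
    · rintro ⟨x, hx⟩
      obtain ⟨y, rfl⟩ := (hd x).1 hx
      exact ⟨y, rfl⟩
    · rw [← Subtype.coe_inj]
      exact hd' 0 x
  · rintro ⟨M', F₀, f, g, h, hF, F, ε, d, hX, h0, hε, hd, hd'⟩
    refine ⟨fun i => Nat.casesOn i F₀ F, ModuleCat.ofHom g,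
      fun i => Nat.casesOn i (ε ≫ ModuleCat.ofHom f) d, ?_, ?_, h.surjective, fun x => ?_, ?_⟩
    · rintro (_ | i) hi
      · exact hF
      · exact hX i (by lia)
    · rintro (_ | i) hi
      · lia
      · exact h0 i (by lia)
    · refine (h.exact x).trans ⟨?_, ?_⟩
      · rintro ⟨y, rfl⟩
        obtain ⟨y, rfl⟩ := hε y
        exact ⟨y, rfl⟩
      · rintro ⟨y, rfl⟩
        exact ⟨ε y, rfl⟩
    · rintro (_ | i)
      · intro x
        refine Iff.trans ?_ (hd x)
        exact map_eq_zero_iff f h.injective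
      · exact hd' i

theorem coresolutionLE_zero [X.IsClosedUnderIsomorphisms] : coresolutionLE X 0 M ↔ X M := by
  constructor
  · rintro ⟨I, ε, d, hX, h0, hε, hd, -⟩
    have := h0 1 (by lia)
    have hs : Function.Surjective ε := fun x => (hd x).1 (Subsingleton.elim _ _)
    exact X.prop_of_iso (LinearEquiv.ofBijective ε.hom ⟨hε, hs⟩).toModuleIso.symm (hX 0 le_rfl)
  · intro h
    refine ⟨fun i => Nat.casesOn i M fun _ => ModuleCat.of A PUnit, 𝟙 M, fun _ => 0, ?_, ?_,
      fun x y h => h, fun x => ⟨fun _ => ⟨x, rfl⟩, fun _ => rfl⟩, fun i x => ?_⟩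
    · rintro i hi
      obtain rfl : i = 0 := by lia
      exact h
    · rintro (_ | i) hi
      · lia
      · exact inferInstanceAs (Subsingleton PUnit)
    · exact ⟨fun _ => ⟨0, Subsingleton.elim (α := PUnit) _ _⟩, fun _ => rfl⟩

theorem coresolutionLE_succ : coresolutionLE X (k + 1) M ↔
    ∃ (I M' : ModuleCat.{u} A) (f : M →ₗ[A] I) (g : I →ₗ[A] M'),
      IsSES f g ∧ X I ∧ coresolutionLE X k M' := by
  constructor
  · rintro ⟨I, ε, d, hX, h0, hε, hd, hd'⟩
    have hle : LinearMap.range ε.hom ≤ LinearMap.ker (d 0).hom := by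
      rintro _ ⟨x, rfl⟩
      exact hd.apply_apply_eq_zero x
    refine ⟨I 0, ModuleCat.of A (I 0 ⧸ LinearMap.range ε.hom), ε.hom, _, .range hε, hX 0 (by lia),
      fun i => I (i + 1), ModuleCat.ofHom ((LinearMap.range ε.hom).liftQ (d 0).hom hle),
      fun i => d (i + 1), fun i hi => hX _ (by lia), fun i hi => h0 _ (by lia), ?_, fun x => ?_,
      fun i => hd' (i + 1)⟩
    · refine (injective_iff_map_eq_zero
        ((LinearMap.range ε.hom).liftQ (d 0).hom hle)).2 fun x hx => ?_
      obtain ⟨x, rfl⟩ := Submodule.mkQ_surjective _ x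
      exact (Submodule.Quotient.mk_eq_zero _).2 ((hd x).1 hx)
    · refine (hd' 0 x).trans ⟨?_, ?_⟩
      · rintro ⟨y, rfl⟩
        exact ⟨Submodule.Quotient.mk y, rfl⟩
      · rintro ⟨y, rfl⟩
        obtain ⟨y, rfl⟩ := Submodule.mkQ_surjective _ y
        exact ⟨y, rfl⟩
  · rintro ⟨I₀, M', f, g, h, hI, I, ε, d, hX, h0, hε, hd, hd'⟩
    refine ⟨fun i => Nat.casesOn i I₀ I, ModuleCat.ofHom f,
      fun i => Nat.casesOn i (ModuleCat.ofHom g ≫ ε) d, ?_, ?_, h.injective, fun x => ?_, ?_⟩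
    · rintro (_ | i) hi
      · exact hI
      · exact hX i (by lia)
    · rintro (_ | i) hi
      · lia
      · exact h0 i (by lia)
    · refine Iff.trans ?_ (h.exact x)
      exact map_eq_zero_iff ε.hom hε
    · rintro (_ | i)
      · intro x
        refine (hd x).trans ⟨?_, ?_⟩
        · rintro ⟨y, rfl⟩
          obtain ⟨y, rfl⟩ := h.surjective y
          exact ⟨y, rfl⟩
        · rintro ⟨y, rfl⟩
          exact ⟨g y, rfl⟩
      · exact hd' i

theorem IsSES.of_subsingleton_left (M : Type u) [AddCommGroup M] [Module A M] :
    IsSES (0 : PUnit.{u + 1} →ₗ[A] M) (LinearMap.id : M →ₗ[A] M) :=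
  ⟨fun _ _ _ => rfl, fun x => ⟨fun h => ⟨0, h.symm⟩, by rintro ⟨y, rfl⟩; rfl⟩, fun x => ⟨x, rfl⟩⟩

theorem IsSES.of_subsingleton_right (M : Type u) [AddCommGroup M] [Module A M] :
    IsSES (LinearMap.id : M →ₗ[A] M) (0 : M →ₗ[A] PUnit.{u + 1}) :=
  ⟨fun _ _ h => h, fun x => ⟨fun _ => ⟨x, rfl⟩, fun _ => rfl⟩, fun _ => ⟨0, rfl⟩⟩

/-- A zero term is appended at the far end, which is why the class must contain the zero module. -/
theorem resolutionLE_mono [X.IsClosedUnderIsomorphisms] (h0 : X (ModuleCat.of A PUnit))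
    {k l : ℕ} (h : k ≤ l) : resolutionLE X k ≤ resolutionLE X l := by
  induction h with
  | refl => exact le_rfl
  | @step l hl ih =>
    refine ih.trans ?_
    clear ih hl
    induction l with
    | zero =>
      intro M hM
      rw [resolutionLE_zero] at hM
      exact resolutionLE_succ.2 ⟨ModuleCat.of A PUnit, M, 0, _, .of_subsingleton_left M, hM,
        resolutionLE_zero.2 h0⟩
    | succ l ih =>
      intro M hM
      obtain ⟨M', F, f, g, h, hF, hM'⟩ := resolutionLE_succ.1 hM
      exact resolutionLE_succ.2 ⟨M', F, f, g, h, hF, ih _ hM'⟩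

theorem coresolutionLE_mono [X.IsClosedUnderIsomorphisms] (h0 : X (ModuleCat.of A PUnit))
    {k l : ℕ} (h : k ≤ l) : coresolutionLE X k ≤ coresolutionLE X l := by
  induction h with
  | refl => exact le_rfl
  | @step l hl ih =>
    refine ih.trans ?_
    clear ih hl
    induction l with
    | zero =>
      intro M hM
      rw [coresolutionLE_zero] at hM
      exact coresolutionLE_succ.2 ⟨M, ModuleCat.of A PUnit, _, 0, .of_subsingleton_right M, hM,
        coresolutionLE_zero.2 h0⟩
    | succ l ih =>
      intro M hM
      obtain ⟨I, M', f, g, h, hI, hM'⟩ := coresolutionLE_succ.1 hM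
      exact coresolutionLE_succ.2 ⟨I, M', f, g, h, hI, ih _ hM'⟩

theorem le_resolutionLE [X.IsClosedUnderIsomorphisms] (h0 : X (ModuleCat.of A PUnit)) (k : ℕ) :
    X ≤ resolutionLE X k :=
  fun _ hM => resolutionLE_mono h0 (Nat.zero_le k) _ (resolutionLE_zero.2 hM)

theorem le_coresolutionLE [X.IsClosedUnderIsomorphisms] (h0 : X (ModuleCat.of A PUnit)) (k : ℕ) :
    X ≤ coresolutionLE X k :=
  fun _ hM => coresolutionLE_mono h0 (Nat.zero_le k) _ (coresolutionLE_zero.2 hM)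

end Resolution

/-! ### Closure properties of the classes -/

section Classes

variable {R S : Type u} [Ring R] [Ring S] {K : Type u} [AddCommGroup K] [Module S K]
  [Module Rᵐᵒᵖ K] [SMulCommClass S Rᵐᵒᵖ K] {C : Type u} [AddCommGroup C] [Module S C]
  [Module Rᵐᵒᵖ C] [SMulCommClass S Rᵐᵒᵖ C] {n : ℕ∞} {d : ℕ}

theorem ExtZero.of_subsingleton {U Y : Type u} [AddCommGroup U] [Module R U] [AddCommGroup Y]
    [Module R Y] [Subsingleton Y] (i : ℕ) : ExtZero R U Y i := by
  refine subsingleton_of_forall_eq 0 fun x => ?_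
  have h : 𝟙 (ModuleCat.of R Y) = 0 := by
    ext x
    exact Subsingleton.elim _ _
  rw [← Abelian.Ext.comp_mk₀_id x, h, Abelian.Ext.mk₀_zero, Abelian.Ext.comp_zero]

instance : (ndFlat R n d).IsClosedUnderIsomorphisms where
  of_iso e h := ndFlat_iff.2 fun U hU =>
    ExtZero.congr (.refl _ _) (Dual.congr e.toLinearEquiv) (ndFlat_iff.1 h U hU)

instance : (ndInjective S n d).IsClosedUnderIsomorphisms where
  of_iso e h := fun U hU => ExtZero.congr (.refl _ _) e.toLinearEquiv (h U hU)

instance : (relFlat R S K n d).IsClosedUnderIsomorphisms where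
  of_iso e := fun ⟨F, hF, ⟨e'⟩⟩ => ⟨F, hF, ⟨e.symm ≪≫ e'⟩⟩

instance : (relInjective R S K n d).IsClosedUnderIsomorphisms where
  of_iso e := fun ⟨F, hF, ⟨e'⟩⟩ => ⟨F, hF, ⟨e.symm ≪≫ e'⟩⟩

instance : (auslanderClass R S K).IsClosedUnderIsomorphisms where
  of_iso {M M'} e h := by
    have h₃ := h.2.2
    obtain ⟨h₁, h₂, -⟩ := auslanderClass_iff.1 h
    refine auslanderClass_iff.2 ⟨fun i => (h₁ i).congr (.refl _ _) (Dual.congr e.toLinearEquiv),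
      fun i => (h₂ i).congr (.refl _ _) ((tensorFunctor R S K).mapIso e).toLinearEquiv,
      (ConcreteCategory.isIso_iff_bijective _).1
        ((NatTrans.isIso_app_iff_of_iso (unitEval R S K) e).1 h₃)⟩

instance : (bassClass R S K).IsClosedUnderIsomorphisms where
  of_iso {N N'} e h := by
    have h₃ := h.2.2
    obtain ⟨h₁, h₂, -⟩ := bassClass_iff.1 h
    refine bassClass_iff.2 ⟨fun i => (h₁ i).congr (.refl _ _) e.toLinearEquiv,
      fun i => (h₂ i).congr (.refl _ _) (Dual.congr ((homFunctor R S K).mapIso e).toLinearEquiv),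
      (ConcreteCategory.isIso_iff_bijective _).1
        ((NatTrans.isIso_app_iff_of_iso (counitEval R S K) e).1 h₃)⟩

theorem ndFlat_punit : ndFlat R n d (ModuleCat.of R PUnit) :=
  ndFlat_iff.2 fun _ _ =>
    have : Subsingleton (Dual PUnit.{u + 1}) := Dual.subsingleton_iff.2 inferInstance
    ExtZero.of_subsingleton _

theorem ndInjective_punit : ndInjective S n d (ModuleCat.of S PUnit) :=
  fun _ _ => ExtZero.of_subsingleton _

theorem relFlat_punit : relFlat R S K n d (ModuleCat.of S PUnit) := by
  have : Subsingleton (BTensor R K PUnit.{u + 1}) := subsingleton_of_forall_eq 0 fun t => by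
    induction t using BTensor.induction with
    | zero => rfl
    | tmul x y => simpa using BTensor.tmul_add R x (0 : PUnit.{u + 1}) 0
    | add a b ha hb => rw [ha, hb, add_zero]
  exact ⟨ModuleCat.of R PUnit, ndFlat_punit,
    ⟨LinearEquiv.toModuleIso (X₂ := BTensor R K PUnit.{u + 1})
      ⟨0, 0, fun _ => rfl, fun _ => Subsingleton.elim _ _⟩⟩⟩

theorem relInjective_punit : relInjective R S K n d (ModuleCat.of R PUnit) := by
  have : Subsingleton (BHom S K PUnit.{u + 1}) := ⟨fun _ _ => BHom.ext fun _ => rfl⟩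
  exact ⟨ModuleCat.of S PUnit, ndInjective_punit,
    ⟨LinearEquiv.toModuleIso (X₂ := BHom S K PUnit.{u + 1})
      ⟨0, 0, fun _ => rfl, fun _ => Subsingleton.elim _ _⟩⟩⟩

theorem tensorFunctor_map_unitEval_comp (M : ModuleCat.{u} R) :
    (tensorFunctor R S K).map ((unitEval R S K).app M) ≫
      (counitEval R S K).app ((tensorFunctor R S K).obj M) = 𝟙 _ :=
  ModuleCat.hom_ext (LinearMap.toAddMonoidHom_injective (BTensor.addHom_ext R fun _ _ => rfl))

theorem unitEval_comp_homFunctor_map (N : ModuleCat.{u} S) :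
    (unitEval R S K).app ((homFunctor R S K).obj N) ≫
      (homFunctor R S K).map ((counitEval R S K).app N) = 𝟙 _ := rfl

/-- The Ext condition is shared by the two classes, the Tor condition is transported along μ_M, and
the triangle identity makes ν invertible at K ⊗ M. -/
theorem bassClass_tensor {M : ModuleCat.{u} R} (h : auslanderClass R S K M) :
    bassClass R S K ((tensorFunctor R S K).obj M) := by
  have h₃ := h.2.2
  obtain ⟨h₁, h₂, -⟩ := auslanderClass_iff.1 h
  have := IsIso.of_isIso_fac_left (tensorFunctor_map_unitEval_comp (S := S) (K := K) M)
  exact bassClass_iff.2 ⟨h₂, fun i => (h₁ i).congr (.refl _ _)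
    (Dual.congr (asIso ((unitEval R S K).app M)).toLinearEquiv),
    (ConcreteCategory.isIso_iff_bijective _).1 this⟩

theorem auslanderClass_hom {N : ModuleCat.{u} S} (h : bassClass R S K N) :
    auslanderClass R S K ((homFunctor R S K).obj N) := by
  have h₃ := h.2.2
  obtain ⟨h₁, h₂, -⟩ := bassClass_iff.1 h
  have := IsIso.of_isIso_fac_right (unitEval_comp_homFunctor_map (R := R) (K := K) N)
  exact auslanderClass_iff.2 ⟨h₂, fun i => (h₁ i).congr (.refl _ _)
    (asIso ((counitEval R S K).app N)).symm.toLinearEquiv,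
    (ConcreteCategory.isIso_iff_bijective _).1 this⟩

/-- The Foxby equivalence between two subclasses of the Auslander and the Bass class. -/
theorem isFoxbyEquivalence_of {P : ObjectProperty (ModuleCat.{u} R)}
    {Q : ObjectProperty (ModuleCat.{u} S)} (hP : P ≤ auslanderClass R S K)
    (hQ : Q ≤ bassClass R S K) (hT : ∀ M, P M → Q ((tensorFunctor R S K).obj M))
    (hH : ∀ N, Q N → P ((homFunctor R S K).obj N)) : IsFoxbyEquivalence R S K P Q := by
  have hu (M) (h : P M) : IsIso ((unitEval R S K).app M) := (hP M h).2.2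
  have hc (N) (h : Q N) : IsIso ((counitEval R S K).app N) := (hQ N h).2.2
  refine ⟨hT, hH, CategoryTheory.Equivalence.mk
    (Q.lift (P.ι ⋙ tensorFunctor R S K) (fun M => hT _ M.property))
    (P.lift (Q.ι ⋙ homFunctor R S K) (fun N => hH _ N.property))
    (NatIso.ofComponents (fun M => P.isoMk
      (@asIso _ _ _ _ ((unitEval R S K).app M.obj) (hu _ M.property))) ?_)
    (NatIso.ofComponents (fun N => Q.isoMk
      (@asIso _ _ _ _ ((counitEval R S K).app N.obj) (hc _ N.property))) ?_), rfl, rfl, hu, hc⟩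
  · intro M M' f
    ext1
    exact (unitEval R S K).naturality f.hom
  · intro N N' f
    ext1
    exact (counitEval R S K).naturality f.hom

end Classes

/-! ### Dimensions -/

section Dimension

variable {R S : Type u} [Ring R] [Ring S] {n : ℕ∞} {d k : ℕ}

/-- If maps into `Y` extend along monomorphisms, then all higher `Ext` groups into `Y` vanish. -/
theorem ExtZero.of_forall_extension {A : Type u} [Ring A] {Y : Type u} [AddCommGroup Y] [Module A Y]
    (hY : ∀ (U U' : ModuleCat.{u} A) (f : U →ₗ[A] U'), Function.Injective f →
      ∀ φ : U →ₗ[A] Y, ∃ ψ : U' →ₗ[A] Y, ψ ∘ₗ f = φ) (i : ℕ) :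
    ∀ U : ModuleCat.{u} A, ExtZero A U Y (i + 1) := by
  have hs (U : ModuleCat.{u} A) : Function.Surjective (Finsupp.linearCombination A (id : U → U)) :=
    Finsupp.linearCombination_id_surjective A U
  induction i with
  | zero =>
    exact fun U => (IsSES.ker (hs U)).ext_one (.of_projective 0)
      (hY (ModuleCat.of A _) (ModuleCat.of A _) _ Subtype.val_injective)
  | succ i ih =>
    exact fun U => (IsSES.ker (hs U)).ext_right (ih (ModuleCat.of A _)) (.of_projective _)

/-- The character module of a free module is injective. -/
theorem ext_dual_finsupp (ι : Type u) (i : ℕ) (U : ModuleCat.{u} Rᵐᵒᵖ) :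
    ExtZero Rᵐᵒᵖ U (Dual (ι →₀ R)) (i + 1) := by
  refine ExtZero.of_forall_extension (fun U U' f hf φ => ?_) i U
  -- A linear map into the character module of a free module is a family of characters, one per
  -- basis vector; each extends from U to U' because ℚ/ℤ is injective.
  have hχ (j : ι) : ∃ χ : U' →+ AddCircle (1 : ℚ), ∀ x, χ (f x) = φ x (Finsupp.single j 1) := by
    obtain ⟨χ, hχ⟩ := exists_dual_extension (f := f.toAddMonoidHom) hf
      (AddMonoidHom.mk' (fun x => φ x (Finsupp.single j 1)) fun x y => by rw [map_add]; rfl)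
    exact ⟨χ, DFunLike.congr_fun hχ⟩
  choose χ hχ using hχ
  let ψ : U' → ((ι →₀ R) →+ AddCircle (1 : ℚ)) := fun x => Finsupp.liftAddHom fun j =>
    AddMonoidHom.mk' (fun r => χ j (MulOpposite.op r • x)) fun r r' => by
      rw [MulOpposite.op_add, add_smul, map_add]
  have hψ (x : U') (j : ι) (r : R) : ψ x (Finsupp.single j r) = χ j (MulOpposite.op r • x) := by
    simp [ψ]
  refine ⟨{ toFun := fun x => (ψ x : Dual (ι →₀ R)), map_add' := fun x y => ?_,
            map_smul' := fun r x => ?_ }, ?_⟩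
  · refine Finsupp.addHom_ext fun j r => ?_
    change ψ (x + y) _ = ψ x _ + ψ y _
    rw [hψ, hψ, hψ, smul_add, map_add]
  · refine Finsupp.addHom_ext fun j s => ?_
    change ψ (r • x) _ = ψ x (r.unop • Finsupp.single j s)
    rw [Finsupp.smul_single, hψ, hψ, smul_eq_mul, MulOpposite.op_mul, mul_smul, MulOpposite.op_unop]
  · ext x : 1
    refine Finsupp.addHom_ext fun j r => ?_
    change ψ (f x) _ = φ x _
    rw [hψ, ← map_smul, hχ, map_smul, Dual.smul_apply]
    simp

/-- In the dual of a free cover the middle term is injective, so passing to the kernel lowers the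
vanishing degree by one, down to d + 1. -/
theorem resolutionLE_of_ext_dual (j : ℕ) : ∀ N : ModuleCat.{u} R,
    (∀ U : ModuleCat.{u} Rᵐᵒᵖ, FinPresented Rᵐᵒᵖ n U → ExtZero Rᵐᵒᵖ U (Dual N) (d + j + 1)) →
    resolutionLE (ndFlat R n d) j N := by
  induction j with
  | zero => exact fun N h => resolutionLE_zero.2 (ndFlat_iff.2 h)
  | succ j ih =>
    intro N h
    have hs := IsSES.ker (Finsupp.linearCombination_id_surjective R N)
    exact resolutionLE_succ.2 ⟨ModuleCat.of R _, ModuleCat.of R (N →₀ R), _, _, hs,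
      ndFlat_iff.2 fun U _ => ext_dual_finsupp N d U, ih _ fun U hU =>
        hs.dual.coext_right (h U hU) (ext_dual_finsupp N _ U)⟩

theorem coresolutionLE_of_ext (j : ℕ) : ∀ M : ModuleCat.{u} S,
    (∀ U : ModuleCat.{u} S, FinPresented S n U → ExtZero S U M (d + j + 1)) →
    coresolutionLE (ndInjective S n d) j M := by
  induction j with
  | zero => exact fun N h => coresolutionLE_zero.2 h
  | succ j ih =>
    intro M h
    have hi : Function.Injective (Injective.ι M).hom :=
      (ModuleCat.mono_iff_injective _).1 inferInstance
    have hI (i : ℕ) (U : ModuleCat.{u} S) : ExtZero S U (Injective.under M : ModuleCat.{u} S) (i + 1) :=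
      subsingleton_of_forall_eq 0
        (Abelian.Ext.eq_zero_of_injective (X := U) (I := Injective.under M))
    exact coresolutionLE_succ.2 ⟨Injective.under M, ModuleCat.of S _, _, _, .range hi,
      fun U _ => hI d U, ih _ fun U hU => (IsSES.range hi).coext_right (h U hU) (hI _ U)⟩

/-- The flat term is only known to be acyclic in degree d + 1; coherence supplies the higher degrees
that the long exact sequence asks for. -/
theorem ext_dual_of_resolutionLE (hR : IsNCoherent Rᵐᵒᵖ n) (k : ℕ) : ∀ N : ModuleCat.{u} R,
    resolutionLE (ndFlat R n d) k N → ∀ U : ModuleCat.{u} Rᵐᵒᵖ, FinPresented Rᵐᵒᵖ n U →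
      ExtZero Rᵐᵒᵖ U (Dual N) (d + k + 1) := by
  induction k with
  | zero => exact fun N h => ndFlat_iff.1 (resolutionLE_zero.1 h)
  | succ k ih =>
    intro N h U hU
    obtain ⟨M', F, f, g, hs, hF, hM'⟩ := resolutionLE_succ.1 h
    exact hs.dual.coext_left (ext_add_of_isNCoherent hR (ndFlat_iff.1 hF) (k + 1) U hU)
      (ih M' hM' U hU)

theorem ext_of_coresolutionLE (hS : IsNCoherent S n) (k : ℕ) : ∀ M : ModuleCat.{u} S,
    coresolutionLE (ndInjective S n d) k M → ∀ U : ModuleCat.{u} S, FinPresented S n U →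
      ExtZero S U M (d + k + 1) := by
  induction k with
  | zero => exact fun M h => coresolutionLE_zero.1 h
  | succ k ih =>
    intro M h U hU
    obtain ⟨I, M', f, g, hs, hI, hM'⟩ := coresolutionLE_succ.1 h
    exact hs.coext_left (ext_add_of_isNCoherent hS hI (k + 1) U hU) (ih M' hM' U hU)

theorem exists_le_of_iInf_le {p : ℕ → Prop} {k : ℕ} (h : ⨅ (j : ℕ) (_ : p j), (j : ℕ∞) ≤ k) :
    ∃ j ≤ k, p j := by
  by_contra! hp
  have : ((k + 1 : ℕ) : ℕ∞) ≤ ⨅ (j : ℕ) (_ : p j), (j : ℕ∞) := le_iInf₂ fun j hj => by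
    have : k < j := lt_of_not_ge fun hle => hp j hle hj
    exact_mod_cast this
  have := this.trans h
  norm_cast at this
  lia

theorem resolutionLE_of_torDim_le {N : ModuleCat.{u} R} (h : torDim R n d N ≤ k) :
    resolutionLE (ndFlat R n d) k N := by
  -- The vanishing may already occur at some j < k; the shorter resolution is then padded with
  -- zeros.
  obtain ⟨j, hj, hp⟩ := exists_le_of_iInf_le h
  exact resolutionLE_mono ndFlat_punit hj _
    (resolutionLE_of_ext_dual j N fun U hU => (tor_succ_iff _).1 (hp U hU))

theorem torDim_le_of_resolutionLE (hR : IsNCoherent Rᵐᵒᵖ n) {N : ModuleCat.{u} R}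
    (h : resolutionLE (ndFlat R n d) k N) : torDim R n d N ≤ k :=
  iInf₂_le k fun U hU => (tor_succ_iff _).2 (ext_dual_of_resolutionLE hR k N h U hU)

theorem coresolutionLE_of_extDim_le {M : ModuleCat.{u} S} (h : extDim S n d M ≤ k) :
    coresolutionLE (ndInjective S n d) k M := by
  obtain ⟨j, hj, hp⟩ := exists_le_of_iInf_le h
  exact coresolutionLE_mono ndInjective_punit hj _ (coresolutionLE_of_ext j M hp)

theorem extDim_le_of_coresolutionLE (hS : IsNCoherent S n) {M : ModuleCat.{u} S}
    (h : coresolutionLE (ndInjective S n d) k M) : extDim S n d M ≤ k :=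
  iInf₂_le k (ext_of_coresolutionLE hS k M h)

end Dimension

/-! ### Foxby equivalence -/

section Main

variable {R S : Type u} [Ring R] [Ring S] {K : Type u} [AddCommGroup K] [Module S K]
  [Module Rᵐᵒᵖ K] [SMulCommClass S Rᵐᵒᵖ K] {C : Type u} [AddCommGroup C] [Module S C]
  [Module Rᵐᵒᵖ C] [SMulCommClass S Rᵐᵒᵖ C] {n : ℕ∞} {d : ℕ}
  {X : ObjectProperty (ModuleCat.{u} R)} {Y : ObjectProperty (ModuleCat.{u} S)}

/-- A resolved module is the right-hand term of a short exact sequence and a coresolved one the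
left-hand term. So faithfulness is needed here and for coresolutions in the Bass class, but not in
the other two cases. -/
theorem resolutionLE_le_auslanderClass (hK : IsFaithfullySemidualizing R S K)
    [X.IsClosedUnderIsomorphisms] (hX : X ≤ auslanderClass R S K) (k : ℕ) :
    resolutionLE X k ≤ auslanderClass R S K := by
  induction k with
  | zero => exact fun M hM => hX _ (resolutionLE_zero.1 hM)
  | succ k ih =>
    intro M hM
    obtain ⟨M', F, f, g, hs, hF, hM'⟩ := resolutionLE_succ.1 hM
    exact hs.auslanderClass_right hK (ih _ hM') (hX _ hF)

theorem coresolutionLE_le_auslanderClass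
    [X.IsClosedUnderIsomorphisms] (hX : X ≤ auslanderClass R S K) (k : ℕ) :
    coresolutionLE X k ≤ auslanderClass R S K := by
  induction k with
  | zero => exact fun M hM => hX _ (coresolutionLE_zero.1 hM)
  | succ k ih =>
    intro M hM
    obtain ⟨I, M', f, g, hs, hI, hM'⟩ := coresolutionLE_succ.1 hM
    exact hs.auslanderClass_left (hX _ hI) (ih _ hM')

theorem resolutionLE_le_bassClass
    [Y.IsClosedUnderIsomorphisms] (hY : Y ≤ bassClass R S K) (k : ℕ) :
    resolutionLE Y k ≤ bassClass R S K := by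
  induction k with
  | zero => exact fun M hM => hY _ (resolutionLE_zero.1 hM)
  | succ k ih =>
    intro M hM
    obtain ⟨M', F, f, g, hs, hF, hM'⟩ := resolutionLE_succ.1 hM
    exact hs.bassClass_right (ih _ hM') (hY _ hF)

theorem coresolutionLE_le_bassClass (hK : IsFaithfullySemidualizing R S K)
    [Y.IsClosedUnderIsomorphisms] (hY : Y ≤ bassClass R S K) (k : ℕ) :
    coresolutionLE Y k ≤ bassClass R S K := by
  induction k with
  | zero => exact fun M hM => hY _ (coresolutionLE_zero.1 hM)
  | succ k ih =>
    intro M hM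
    obtain ⟨I, M', f, g, hs, hI, hM'⟩ := coresolutionLE_succ.1 hM
    exact hs.bassClass_left hK (hY _ hI) (ih _ hM')

variable [X.IsClosedUnderIsomorphisms] [Y.IsClosedUnderIsomorphisms]

/-- The functor preserves the short exact sequence because Tor_1(K, M) = 0 for the resolved module
M, already known to lie in the Auslander class. In `resolutionLE_hom` it is the kernel N' whose
Ext^1 must vanish. -/
theorem resolutionLE_tensor (hK : IsFaithfullySemidualizing R S K) (hX : X ≤ auslanderClass R S K)
    (hXY : ∀ M, X M → Y ((tensorFunctor R S K).obj M)) (k : ℕ) :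
    ∀ M, resolutionLE X k M → resolutionLE Y k ((tensorFunctor R S K).obj M) := by
  induction k with
  | zero => exact fun M hM => resolutionLE_zero.2 (hXY _ (resolutionLE_zero.1 hM))
  | succ k ih =>
    intro M hM
    have hA := auslanderClass_iff.1 (resolutionLE_le_auslanderClass hK hX (k + 1) M hM)
    obtain ⟨M', F, f, g, hs, hF, hM'⟩ := resolutionLE_succ.1 hM
    exact resolutionLE_succ.2 ⟨_, _, _, _, hs.tensor_of_ext (S := S) (hA.1 0), hXY _ hF, ih _ hM'⟩

theorem resolutionLE_hom (hY : Y ≤ bassClass R S K)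
    (hYX : ∀ N, Y N → X ((homFunctor R S K).obj N)) (k : ℕ) :
    ∀ N, resolutionLE Y k N → resolutionLE X k ((homFunctor R S K).obj N) := by
  induction k with
  | zero => exact fun N hN => resolutionLE_zero.2 (hYX _ (resolutionLE_zero.1 hN))
  | succ k ih =>
    intro N hN
    obtain ⟨N', F, f, g, hs, hF, hN'⟩ := resolutionLE_succ.1 hN
    have hB := bassClass_iff.1 (resolutionLE_le_bassClass hY k N' hN')
    exact resolutionLE_succ.2 ⟨_, _, _, _, hs.hom_of_ext (R := R) (hB.1 0), hYX _ hF, ih _ hN'⟩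

theorem coresolutionLE_tensor (hX : X ≤ auslanderClass R S K)
    (hXY : ∀ M, X M → Y ((tensorFunctor R S K).obj M)) (k : ℕ) :
    ∀ M, coresolutionLE X k M → coresolutionLE Y k ((tensorFunctor R S K).obj M) := by
  induction k with
  | zero => exact fun M hM => coresolutionLE_zero.2 (hXY _ (coresolutionLE_zero.1 hM))
  | succ k ih =>
    intro M hM
    obtain ⟨I, M', f, g, hs, hI, hM'⟩ := coresolutionLE_succ.1 hM
    have hA := auslanderClass_iff.1 (coresolutionLE_le_auslanderClass hX k M' hM')
    exact coresolutionLE_succ.2 ⟨_, _, _, _, hs.tensor_of_ext (S := S) (hA.1 0), hXY _ hI, ih _ hM'⟩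

theorem coresolutionLE_hom (hK : IsFaithfullySemidualizing R S K) (hY : Y ≤ bassClass R S K)
    (hYX : ∀ N, Y N → X ((homFunctor R S K).obj N)) (k : ℕ) :
    ∀ N, coresolutionLE Y k N → coresolutionLE X k ((homFunctor R S K).obj N) := by
  induction k with
  | zero => exact fun N hN => coresolutionLE_zero.2 (hYX _ (coresolutionLE_zero.1 hN))
  | succ k ih =>
    intro N hN
    have hB := bassClass_iff.1 (coresolutionLE_le_bassClass hK hY (k + 1) N hN)
    obtain ⟨I, N', f, g, hs, hI, hN'⟩ := coresolutionLE_succ.1 hN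
    exact coresolutionLE_succ.2 ⟨_, _, _, _, hs.hom_of_ext (R := R) (hB.1 0), hYX _ hI, ih _ hN'⟩

theorem relFlat_le_bassClass (hK : IsSpecialFaithfullySemidualizing R S K d C) :
    relFlat R S K n d ≤ bassClass R S K := fun _ ⟨F, hF, ⟨e⟩⟩ =>
  (bassClass R S K).prop_of_iso e.symm (bassClass_tensor (ndFlat_le_auslanderClass hK F hF))

theorem relInjective_le_auslanderClass (hK : IsSpecialFaithfullySemidualizing R S K d C) :
    relInjective R S K n d ≤ auslanderClass R S K := fun _ ⟨I, hI, ⟨e⟩⟩ =>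
  (auslanderClass R S K).prop_of_iso e.symm (auslanderClass_hom (ndInjective_le_bassClass hK I hI))

theorem relFlat_tensor {F : ModuleCat.{u} R} (hF : ndFlat R n d F) :
    relFlat R S K n d ((tensorFunctor R S K).obj F) :=
  ⟨F, hF, ⟨Iso.refl _⟩⟩

theorem relInjective_hom {I : ModuleCat.{u} S} (hI : ndInjective S n d I) :
    relInjective R S K n d ((homFunctor R S K).obj I) :=
  ⟨I, hI, ⟨Iso.refl _⟩⟩

/-- μ_F identifies Hom(K, K ⊗ F) with F, so no flatness has to be proved anew. -/
theorem ndFlat_hom (hK : IsSpecialFaithfullySemidualizing R S K d C) {N : ModuleCat.{u} S}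
    (hN : relFlat R S K n d N) : ndFlat R n d ((homFunctor R S K).obj N) := by
  obtain ⟨F, hF, ⟨e⟩⟩ := hN
  have := (ndFlat_le_auslanderClass hK F hF).2.2
  exact (ndFlat R n d).prop_of_iso
    (asIso ((unitEval R S K).app F) ≪≫ (homFunctor R S K).mapIso e.symm) hF

theorem ndInjective_tensor (hK : IsSpecialFaithfullySemidualizing R S K d C) {M : ModuleCat.{u} R}
    (hM : relInjective R S K n d M) : ndInjective S n d ((tensorFunctor R S K).obj M) := by
  obtain ⟨I, hI, ⟨e⟩⟩ := hM
  have := (ndInjective_le_bassClass hK I hI).2.2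
  exact (ndInjective S n d).prop_of_iso
    ((tensorFunctor R S K).mapIso e ≪≫ asIso ((counitEval R S K).app I)).symm hI

end Main

end Foxby

theorem mainTheorem3 (R S : Type u) [Ring R] [Ring S]
    (C : Type u) [AddCommGroup C] [Module S C] [Module Rᵐᵒᵖ C] [SMulCommClass S Rᵐᵒᵖ C]
    (K : Type u) [AddCommGroup K] [Module S K] [Module Rᵐᵒᵖ K] [SMulCommClass S Rᵐᵒᵖ K]
    (n : ℕ∞) (d k : ℕ) (hd : 1 ≤ d) (hn : (d : ℕ∞) + 1 < n)
    (hK : Foxby.IsSpecialFaithfullySemidualizing R S K d C) :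
    -- the five equivalences, from top to bottom
    (Foxby.IsFoxbyEquivalence R S K (Foxby.ndFlat R n d) (Foxby.relFlat R S K n d) ∧
      Foxby.IsFoxbyEquivalence R S K (Foxby.resolutionLE (Foxby.ndFlat R n d) k)
        (Foxby.resolutionLE (Foxby.relFlat R S K n d) k) ∧
      Foxby.IsFoxbyEquivalence R S K (Foxby.auslanderClass R S K) (Foxby.bassClass R S K) ∧
      Foxby.IsFoxbyEquivalence R S K (Foxby.coresolutionLE (Foxby.relInjective R S K n d) k)
        (Foxby.coresolutionLE (Foxby.ndInjective S n d) k) ∧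
      Foxby.IsFoxbyEquivalence R S K (Foxby.relInjective R S K n d) (Foxby.ndInjective S n d)) ∧
    -- the inclusions of full subcategories of left `R`-modules
    (Foxby.ndFlat R n d ≤ Foxby.resolutionLE (Foxby.ndFlat R n d) k ∧
      Foxby.resolutionLE (Foxby.ndFlat R n d) k ≤ Foxby.auslanderClass R S K ∧
      Foxby.coresolutionLE (Foxby.relInjective R S K n d) k ≤ Foxby.auslanderClass R S K ∧
      Foxby.relInjective R S K n d ≤ Foxby.coresolutionLE (Foxby.relInjective R S K n d) k) ∧
    -- the inclusions of full subcategories of left `S`-modules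
    (Foxby.relFlat R S K n d ≤ Foxby.resolutionLE (Foxby.relFlat R S K n d) k ∧
      Foxby.resolutionLE (Foxby.relFlat R S K n d) k ≤ Foxby.bassClass R S K ∧
      Foxby.coresolutionLE (Foxby.ndInjective S n d) k ≤ Foxby.bassClass R S K ∧
      Foxby.ndInjective S n d ≤ Foxby.coresolutionLE (Foxby.ndInjective S n d) k) ∧
    -- comparison with the dimensions defined by vanishing of Tor and Ext
    ((∀ N, Foxby.torDim R n d N ≤ k → Foxby.resolutionLE (Foxby.ndFlat R n d) k N) ∧
      (Foxby.IsNCoherent Rᵐᵒᵖ n →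
        ∀ N, Foxby.resolutionLE (Foxby.ndFlat R n d) k N → Foxby.torDim R n d N ≤ k) ∧
      (∀ M, Foxby.extDim S n d M ≤ k → Foxby.coresolutionLE (Foxby.ndInjective S n d) k M) ∧
      (Foxby.IsNCoherent S n →
        ∀ M, Foxby.coresolutionLE (Foxby.ndInjective S n d) k M → Foxby.extDim S n d M ≤ k)) := by
  have hK' := hK.toIsFaithfullySemidualizing
  have hF := Foxby.ndFlat_le_auslanderClass (n := n) hK
  have hI := Foxby.ndInjective_le_bassClass (n := n) hK
  have hFK := Foxby.relFlat_le_bassClass (n := n) hK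
  have hIK := Foxby.relInjective_le_auslanderClass (n := n) hK
  have hFA := Foxby.resolutionLE_le_auslanderClass hK' hF k
  have hIA := Foxby.coresolutionLE_le_auslanderClass hIK k
  have hFB := Foxby.resolutionLE_le_bassClass hFK k
  have hIB := Foxby.coresolutionLE_le_bassClass hK' hI k
  refine ⟨⟨?_, ?_, ?_, ?_, ?_⟩, ⟨?_, hFA, hIA, ?_⟩, ⟨?_, hFB, hIB, ?_⟩,
    fun N => Foxby.resolutionLE_of_torDim_le, fun hR N => Foxby.torDim_le_of_resolutionLE hR,
    fun M => Foxby.coresolutionLE_of_extDim_le, fun hS M => Foxby.extDim_le_of_coresolutionLE hS⟩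
  · exact Foxby.isFoxbyEquivalence_of hF hFK (fun _ => Foxby.relFlat_tensor)
      (fun _ => Foxby.ndFlat_hom hK)
  · exact Foxby.isFoxbyEquivalence_of hFA hFB
      (Foxby.resolutionLE_tensor hK' hF (fun _ => Foxby.relFlat_tensor) k)
      (Foxby.resolutionLE_hom hFK (fun _ => Foxby.ndFlat_hom hK) k)
  · exact Foxby.isFoxbyEquivalence_of le_rfl le_rfl (fun _ => Foxby.bassClass_tensor)
      (fun _ => Foxby.auslanderClass_hom)
  · exact Foxby.isFoxbyEquivalence_of hIA hIB
      (Foxby.coresolutionLE_tensor hIK (fun _ => Foxby.ndInjective_tensor hK) k)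
      (Foxby.coresolutionLE_hom hK' hI (fun _ => Foxby.relInjective_hom) k)
  · exact Foxby.isFoxbyEquivalence_of hIK hI (fun _ => Foxby.ndInjective_tensor hK)
      (fun _ => Foxby.relInjective_hom)
  · exact Foxby.le_resolutionLE Foxby.ndFlat_punit k
  · exact Foxby.le_coresolutionLE Foxby.relInjective_punit k
  · exact Foxby.le_resolutionLE Foxby.relFlat_punit k
  · exact Foxby.le_coresolutionLE Foxby.ndInjective_punit k
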